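/- A polynomial-like map of degree $d\ge 2$ is a triple $(f,U,V)$ where $U,V\subset\mathbb C$ are bounded simply connected domains with $\overline U\subset V$ and $f:U\to V$ is a proper analytic map of degree $d$ (every point of $V$ has exactly $d$ preimages in $U$, counted with multiplicity). Its filled-in Julia set is $K(f,U,V)=\{z\in U: f^n(z)\in U\text{ for all }n\ge 1\}$. Let $A\subset\mathbb C$ be a connected open set. A family $\{(f_a,U_a,V_a):a\in A\}$ of polynomial-like maps of degree $d$, with $\mathcal U=\{(a,z):a\in A,\ z\in U_a\}$ and $\mathcal V=\{(a,z):a\in A,\ z\in V_a\}$, is an analytic family of polynomial-like maps of degree $d$ if (1) each of $\mathcal U$ and $\mathcal V$ is homeomorphic to $A\times\mathbb D$ by a homeomorphism preserving the coordinate $a$ (where $\mathbb D$ is the open unit disk); (2) the projection to $A$ from the closure of $\mathcal U$ in $\mathcal V$ is proper; (3) the map $\mathcal U\to\mathcal V$, $(a,z)\mapsto(a,f_a(z))$, is complex-analytic and proper. Here proper means that preimages of compact sets are compact. Proposition. Let $(f,U,V)$ be a polynomial-like map of degree $d\ge 2$, let $r>0$, and let $f_a(z)=f(a,z)$ be complex-analytic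 in $\{|a|<r\}\times U$ with $f_0=f$ on $U$. Let $K$ be any compact set with $K(f,U,V)\subseteq K\subset U$. Then there exist $0<\rho\le r$, a domain $V'\subseteq V$, and domains $U_a$ for $|a|<\rho$ with $K\subseteq U_a\subseteq U$ and $U_a\subseteq V'$, such that $\{(f_a,U_a,V'):|a|<\rho\}$ is an analytic family of polynomial-like maps of degree $d$. -/

import Mathlib

open Set Metric

namespace PolyLike

/-- The map `f` sends `S` into `T` and is proper as a map `S → T`: preimages (in `S`) of compact
subsets of `T` are compact. -/
structure IsProperOn {X Y : Type*} [TopologicalSpace X] [TopologicalSpace Y]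
    (f : X → Y) (S : Set X) (T : Set Y) : Prop where
  mapsTo : MapsTo f S T
  isCompact_preimage : ∀ C : Set Y, C ⊆ T → IsCompact C → IsCompact (S ∩ f ⁻¹' C)

/-- The analytic map `f : U → V` has degree `d`: every `w ∈ V` has finitely many preimages
in `U`, and their number, counted with multiplicity, is `d`. The multiplicity of a preimage `z`
is the order of vanishing of `f - w` at `z`. -/
def HasDegreeOn (f : ℂ → ℂ) (U V : Set ℂ) (d : ℕ) : Prop :=
  ∀ w ∈ V, (U ∩ f ⁻¹' {w}).Finite ∧
    ∑ᶠ z ∈ U ∩ f ⁻¹' {w}, analyticOrderNatAt (fun ζ => f ζ - w) z = d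

/-- `(f, U, V)` is a polynomial-like map of degree `d ≥ 2`. The map `f` is regarded as undefined
outside of `U`, its values there are irrelevant. -/
structure IsPolynomialLike (d : ℕ) (f : ℂ → ℂ) (U V : Set ℂ) : Prop where
  two_le_degree : 2 ≤ d
  isOpen_source : IsOpen U
  isOpen_target : IsOpen V
  simplyConnected_source : IsSimplyConnected U
  simplyConnected_target : IsSimplyConnected V
  isBounded_source : Bornology.IsBounded U
  isBounded_target : Bornology.IsBounded V
  closure_subset : closure U ⊆ V
  analytic : AnalyticOnNhd ℂ f U
  proper : IsProperOn f U V
  degree : HasDegreeOn f U V d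

/-- The filled-in Julia set `K(f, U, V)`. -/
def filledJulia (f : ℂ → ℂ) (U : Set ℂ) : Set ℂ :=
  {z | z ∈ U ∧ ∀ n : ℕ, 1 ≤ n → f^[n] z ∈ U}

/-- The total space `{(a, z) : a ∈ A, z ∈ W a}` of a family of planar sets. -/
def totalSpace (A : Set ℂ) (W : ℂ → Set ℂ) : Set (ℂ × ℂ) :=
  {p | p.1 ∈ A ∧ p.2 ∈ W p.1}

/-- The total space of the family `W` is homeomorphic over `A` to `A × 𝔻`, that is, by a
homeomorphism which preserves the first coordinate. -/
def IsTrivialDiskFamily (A : Set ℂ) (W : ℂ → Set ℂ) : Prop :=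
  ∃ Φ : totalSpace A W ≃ₜ A × ball (0 : ℂ) 1, ∀ p, ((Φ p).1 : ℂ) = (p : ℂ × ℂ).1

/-- The family `(f a, U a, V a)`, `a ∈ A`, is an analytic family of polynomial-like maps of
degree `d`, where the parameter manifold `A` is a connected open subset of `ℂ`. -/
structure IsAnalyticFamily (d : ℕ) (A : Set ℂ) (f : ℂ → ℂ → ℂ) (U V : ℂ → Set ℂ) : Prop where
  isOpen_param : IsOpen A
  isConnected_param : IsConnected A
  polynomialLike : ∀ a ∈ A, IsPolynomialLike d (f a) (U a) (V a)
  trivial_source : IsTrivialDiskFamily A U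
  trivial_target : IsTrivialDiskFamily A V
  /-- The projection to `A` from the closure of the total space of `U` relative to the total
  space of `V` is proper. -/
  proper_projection :
    IsProperOn Prod.fst (closure (totalSpace A U) ∩ totalSpace A V) A
  analytic : AnalyticOnNhd ℂ (fun p : ℂ × ℂ => (p.1, f p.1 p.2)) (totalSpace A U)
  proper : IsProperOn (fun p : ℂ × ℂ => (p.1, f p.1 p.2)) (totalSpace A U) (totalSpace A V)

end PolyLike

/-! Near a point where `f` is not critical, the equation `F 0 (h (a, z)) = F a z` can be solved by
an analytic `h` with `h (0, z) = z`. If the boundary of the preimage `S` of a smaller range `V'`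
carries no critical points, such lifts exist in a neighbourhood of that whole boundary. Cutting off
their displacement gives homeomorphisms `H (a, ·)` of the plane close to the identity, and the
domains sought are the preimages of `S` under `H (a, ·)`. They are simply connected, trivialised by
`H`, and `F a` is proper on them because their boundary is sent outside `V'`. This is
`exists_perturbation` and `exists_isAnalyticFamily`.

The range must be chosen so that `S` is simply connected and has a regular boundary
(`IsPolynomialLike.exists_shrink`). Take `V'` to be the part of `V` which a Riemann map sends into a
disk of radius `s < 1`. In Riemann coordinates on source and target `f` is a finite Blaschke
product, whose sublevel sets are star-shaped for `s` close to 1 (`exists_starConvex_sublevel`).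
Critical points are countable, so almost every `s` avoids them.

The degree of `F a` is constant in its target value (`exists_hasDegreeOn`), so it suffices to count
over one value `w` of `V'` all of whose preimages lie near the boundary of `S`. There `H (a, ·)`
matches the preimages under `F a` and under `F 0`, and all of them are simple. -/

namespace PolyLike

open Filter Topology ComplexConjugate

/-! ### The Riemann mapping theorem for bounded simply connected domains. -/

/-- The disk automorphism (Blaschke factor) with zero at `w`. -/
noncomputable def mob (w z : ℂ) : ℂ := (z - w) / (1 - conj w * z)

/-- For `‖w‖ < 1` the sign of the right side decides whether `mob w z` has modulus below, equal to
or above 1; the estimates on Blaschke factors come from this identity. -/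
lemma norm_sq_one_sub_sub (w z : ℂ) :
    ‖1 - conj w * z‖ ^ 2 - ‖z - w‖ ^ 2 = (1 - ‖w‖ ^ 2) * (1 - ‖z‖ ^ 2) := by
  simp only [Complex.sq_norm, Complex.normSq_apply, Complex.sub_re, Complex.sub_im, Complex.one_re,
    Complex.one_im, Complex.mul_re, Complex.mul_im, Complex.conj_re, Complex.conj_im]
  ring

lemma one_sub_conj_mul_ne_zero {w z : ℂ} (hw : ‖w‖ < 1) (hz : ‖z‖ ≤ 1) : 1 - conj w * z ≠ 0 := by
  intro h
  have h1 : ‖conj w * z‖ = 1 := by rw [← sub_eq_zero.1 h]; simp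
  rw [norm_mul, RCLike.norm_conj] at h1
  nlinarith [norm_nonneg w, norm_nonneg z]

lemma norm_mob_lt_one {w z : ℂ} (hw : ‖w‖ < 1) (hz : ‖z‖ < 1) : ‖mob w z‖ < 1 := by
  rw [mob, norm_div, div_lt_one (norm_pos_iff.2 (one_sub_conj_mul_ne_zero hw hz.le))]
  refine lt_of_pow_lt_pow_left₀ 2 (norm_nonneg _) ?_
  have := norm_sq_one_sub_sub w z
  have h1 : 0 < 1 - ‖w‖ ^ 2 := by nlinarith [norm_nonneg w]
  have h2 : 0 < 1 - ‖z‖ ^ 2 := by nlinarith [norm_nonneg z]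
  nlinarith [mul_pos h1 h2]

lemma hasDerivAt_mob {w z : ℂ} (h : 1 - conj w * z ≠ 0) :
    HasDerivAt (mob w) ((1 - conj w * w) / (1 - conj w * z) ^ 2) z := by
  have h1 : HasDerivAt (fun z : ℂ => z - w) 1 z := (hasDerivAt_id z).sub_const w
  have h2 : HasDerivAt (fun z : ℂ => 1 - conj w * z) (-(conj w)) z := by
    simpa using ((hasDerivAt_id z).const_mul (conj w)).const_sub 1
  exact (h1.div h2 h).congr_deriv (by ring)

lemma one_sub_conj_mul_self_ne_zero {w : ℂ} (hw : ‖w‖ < 1) : 1 - conj w * w ≠ 0 :=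
  one_sub_conj_mul_ne_zero hw hw.le

lemma mob_injOn {w : ℂ} (hw : ‖w‖ < 1) : InjOn (mob w) (ball 0 1) := by
  intro x hx y hy h
  simp only [mem_ball_zero_iff] at hx hy
  simp only [mob] at h
  rw [div_eq_div_iff (one_sub_conj_mul_ne_zero hw hx.le) (one_sub_conj_mul_ne_zero hw hy.le)] at h
  have : (x - y) * (1 - conj w * w) = 0 := by linear_combination h
  rcases mul_eq_zero.1 this with h | h
  · exact sub_eq_zero.1 h
  · exact absurd h (one_sub_conj_mul_self_ne_zero hw)

/-- Hurwitz's theorem, local form. -/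
lemma eventually_eq_zero_of_tendstoLocallyUniformlyOn {ι : Type*} {l : Filter ι} [l.NeBot]
    {F : ι → ℂ → ℂ} {g : ℂ → ℂ} {U : Set ℂ} (hU : IsOpen U)
    (hF : ∀ i, DifferentiableOn ℂ (F i) U) (hF0 : ∀ i, ∀ z ∈ U, F i z ≠ 0)
    (hlim : TendstoLocallyUniformlyOn F g l U) {z : ℂ} (hz : z ∈ U) (hgz : g z = 0) :
    ∀ᶠ x in 𝓝 z, g x = 0 := by
  have hg : DifferentiableOn ℂ g U := hlim.differentiableOn (.of_forall hF) hU
  have hga : AnalyticAt ℂ g z := hg.analyticAt (hU.mem_nhds hz)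
  refine hga.eventually_eq_zero_or_eventually_ne_zero.resolve_right fun hne => ?_
  rw [eventually_nhdsWithin_iff] at hne
  obtain ⟨ρ, hρ, hball⟩ := Metric.eventually_nhds_iff.1 (hne.and (hU.eventually_mem hz))
  have hρ2 : 0 < ρ / 2 := by positivity
  have hsub : closedBall z (ρ / 2) ⊆ U := fun x hx => (hball (by
    rw [mem_closedBall] at hx; linarith)).2
  have hsne : ∀ x ∈ sphere z (ρ / 2), g x ≠ 0 := fun x hx => by
    rw [mem_sphere] at hx
    refine (hball (by linarith)).1 ?_
    rintro rfl
    simp at hx; linarith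
  obtain ⟨x₀, hx₀, hmin⟩ := (isCompact_sphere z (ρ / 2)).exists_isMinOn
    (NormedSpace.sphere_nonempty.2 hρ2.le)
    ((hg.continuousOn.mono (sphere_subset_closedBall.trans hsub)).norm)
  have hm : 0 < ‖g x₀‖ := norm_pos_iff.2 (hsne x₀ hx₀)
  have hunif := (tendstoLocallyUniformlyOn_iff_forall_isCompact hU).1 hlim _ hsub
    (isCompact_closedBall z (ρ / 2))
  obtain ⟨i, hi⟩ := (Metric.tendstoUniformlyOn_iff.1 hunif (‖g x₀‖ / 2) (by positivity)).exists
  have hlow : ∀ x ∈ sphere z (ρ / 2), ‖g x₀‖ / 2 ≤ ‖F i x‖ := fun x hx => by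
    have h1 := hi x (sphere_subset_closedBall hx)
    have h2 : ‖g x₀‖ ≤ ‖g x‖ := hmin hx
    rw [dist_eq_norm] at h1
    have h3 := norm_sub_norm_le (g x) (F i x)
    linarith
  -- The maximum principle for the reciprocal of the zero-free `F i` turns the lower bound on the
  -- circle into one at the centre, where `F i z` is too close to `g z = 0`.
  have hd : DiffContOnCl ℂ (fun x => (F i x)⁻¹) (ball z (ρ / 2)) := by
    refine DifferentiableOn.diffContOnCl ?_
    rw [closure_ball _ hρ2.ne']
    exact ((hF i).mono hsub).inv fun x hx => hF0 i x (hsub hx)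
  have hle := Complex.norm_le_of_forall_mem_frontier_norm_le isBounded_ball hd
    (C := (‖g x₀‖ / 2)⁻¹) (fun x hx => by
      rw [frontier_ball _ hρ2.ne'] at hx
      rw [norm_inv]
      exact inv_anti₀ (by positivity) (hlow x hx))
    (subset_closure (mem_ball_self hρ2))
  rw [norm_inv, inv_le_inv₀ (norm_pos_iff.2 (hF0 i z hz)) (by positivity)] at hle
  have := hi z (mem_closedBall_self hρ2.le)
  rw [hgz, dist_zero_left] at this
  linarith

/-- Montel's theorem along an ultrafilter. -/
lemma exists_tendstoLocallyUniformlyOn_ultrafilter {ι : Type*} (l : Ultrafilter ι)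
    {F : ι → ℂ → ℂ} {U : Set ℂ} (hU : IsOpen U)
    (hF : ∀ i, DifferentiableOn ℂ (F i) U) (hF1 : ∀ i, MapsTo (F i) U (ball 0 1)) :
    ∃ g : ℂ → ℂ, TendstoLocallyUniformlyOn F g l U := by
  -- Along an ultrafilter, compactness of the closed disk gives all pointwise limits at once, with
  -- no diagonal extraction.
  have hlim : ∀ z, ∃ w, z ∈ U → Tendsto (fun i => F i z) l (𝓝 w) := by
    intro z
    by_cases hz : z ∈ U
    · obtain ⟨w, -, hw⟩ := (isCompact_closedBall (0 : ℂ) 1).ultrafilter_le_nhds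
        (l.map fun i => F i z) (by
          rw [le_principal_iff]
          exact mem_map.2 (univ_mem' fun i => ball_subset_closedBall (hF1 i hz)))
      exact ⟨w, fun _ => hw⟩
    · exact ⟨0, fun h => absurd h hz⟩
  choose g hg using hlim
  refine ⟨g, Metric.tendstoLocallyUniformlyOn_iff.2 fun ε hε z hz => ?_⟩
  obtain ⟨ρ, hρ, hball⟩ := Metric.isOpen_iff.1 hU z hz
  -- Cauchy's estimate on circles of radius `ρ / 4` gives a Lipschitz constant independent of `i`;
  -- this equicontinuity makes the pointwise limit locally uniform.
  have hlip : ∀ i, ∀ x ∈ ball z (ρ / 2), ‖F i x - F i z‖ ≤ (1 / (ρ / 4)) * ‖x - z‖ := by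
    intro i x hx
    refine (convex_ball z (ρ / 2)).norm_image_sub_le_of_norm_deriv_le (𝕜 := ℂ) ?_ ?_
      (mem_ball_self (by positivity)) hx
    · intro y hy
      refine (hF i).differentiableAt (hU.mem_nhds (hball ?_))
      exact ball_subset_ball (by linarith) hy
    · intro y hy
      have hcb : closedBall y (ρ / 4) ⊆ U := fun u hu => hball (by
        rw [mem_closedBall] at hu
        rw [mem_ball] at hy ⊢
        linarith [dist_triangle u y z])
      refine Complex.norm_deriv_le_of_forall_mem_sphere_norm_le (by positivity) ?_ ?_
      · refine DifferentiableOn.diffContOnCl ?_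
        rw [closure_ball _ (by positivity)]
        exact (hF i).mono hcb
      · intro u hu
        exact (mem_ball_zero_iff.1 (hF1 i (hcb (sphere_subset_closedBall hu)))).le
  set η := min (ρ / 2) (ρ / 4 * (ε / 4)) with hη
  have hη0 : 0 < η := by positivity
  have hbd : ∀ x ∈ ball z η, ∀ i, ‖F i x - F i z‖ ≤ ε / 4 := by
    intro x hx i
    refine (hlip i x (ball_subset_ball (min_le_left _ _) hx)).trans ?_
    rw [mem_ball, dist_eq_norm] at hx
    have : ‖x - z‖ ≤ ρ / 4 * (ε / 4) := hx.le.trans (min_le_right _ _)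
    calc 1 / (ρ / 4) * ‖x - z‖ ≤ 1 / (ρ / 4) * (ρ / 4 * (ε / 4)) := by gcongr
      _ = ε / 4 := by field_simp
  refine ⟨ball z η, mem_nhdsWithin_of_mem_nhds (ball_mem_nhds z hη0), ?_⟩
  have hev := (Metric.tendsto_nhds.1 (hg z hz)) (ε / 4) (by positivity)
  filter_upwards [hev] with i hi x hx
  have hxU : x ∈ U := hball (ball_subset_ball ((min_le_left _ _).trans (by linarith)) hx)
  have h1 : ‖g x - g z‖ ≤ ε / 4 :=
    le_of_tendsto ((hg x hxU).sub (hg z hz)).norm (.of_forall fun i => hbd x hx i)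
  have h2 := hbd x hx i
  rw [← dist_eq_norm] at h1 h2
  have h3 := dist_triangle4 (g x) (g z) (F i z) (F i x)
  rw [dist_comm (g z) (F i z), dist_comm (F i z) (F i x)] at h3
  linarith

/-- `φ : X → Y` and `ψ : Y → X` are mutually inverse analytic maps. -/
structure Biholo (φ ψ : ℂ → ℂ) (X Y : Set ℂ) : Prop where
  analytic : AnalyticOnNhd ℂ φ X
  analytic_inv : AnalyticOnNhd ℂ ψ Y
  mapsTo : MapsTo φ X Y
  mapsTo_inv : MapsTo ψ Y X
  left_inv : ∀ x ∈ X, ψ (φ x) = x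
  right_inv : ∀ y ∈ Y, φ (ψ y) = y

/-- An analytic branch of the square root. -/
lemma exists_analytic_sqrt {U : Set ℂ} (hUo : IsOpen U) (hUc : IsSimplyConnected U) {h : ℂ → ℂ}
    (hh : DifferentiableOn ℂ h U) (h0 : ∀ z ∈ U, h z ≠ 0) :
    ∃ q : ℂ → ℂ, (∀ z, q z ^ 2 = h z) ∧ ∀ z ∈ U, HasDerivAt q (deriv h z / (2 * q z)) z := by
  obtain ⟨q, hqc, hq⟩ := Complex.exists_continuousOn_pow_eq hUc hUo hh.continuousOn
    (by rintro ⟨z, hz, hz0⟩; exact h0 z hz hz0) two_ne_zero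
  refine ⟨q, hq, fun z hz => ?_⟩
  have hqz : q z ≠ 0 := fun h => h0 z hz (by rw [← hq, h]; simp)
  have hcont : ContinuousAt q z := hqc.continuousAt (hUo.mem_nhds hz)
  have hd := (hh.differentiableAt (hUo.mem_nhds hz)).hasDerivAt
  rw [hasDerivAt_iff_tendsto_slope] at hd ⊢
  -- Since `h = q ^ 2`, the difference quotient of `q` is that of `h` divided by `q x + q z`.
  have hsum : Tendsto (fun x => q x + q z) (𝓝[≠] z) (𝓝 (2 * q z)) := by
    rw [two_mul]
    exact (hcont.tendsto.mono_left nhdsWithin_le_nhds).add_const _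
  have h2 : (2 * q z) ≠ 0 := mul_ne_zero two_ne_zero hqz
  refine (hd.div hsum h2).congr' ?_
  filter_upwards [hsum.eventually_ne h2] with x hx
  change (x - z)⁻¹ * (h x - h z) / (q x + q z) = (x - z)⁻¹ * (q x - q z)
  rw [div_eq_iff hx, ← hq, ← hq]
  ring

/-- Injective analytic maps of `U` into the unit disk which vanish at `z₀` and have no critical
points. -/
structure IsRiemannCandidate (U : Set ℂ) (z₀ : ℂ) (f : ℂ → ℂ) : Prop where
  differentiableOn : DifferentiableOn ℂ f U
  mapsTo : MapsTo f U (ball 0 1)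
  injOn : InjOn f U
  deriv_ne : ∀ z ∈ U, deriv f z ≠ 0
  map_base : f z₀ = 0

/-- A candidate which is not onto the disk can be improved. -/
lemma IsRiemannCandidate.exists_lt {U : Set ℂ} (hUo : IsOpen U) (hUc : IsSimplyConnected U)
    {z₀ : ℂ} (hz₀ : z₀ ∈ U) {f : ℂ → ℂ} (hf : IsRiemannCandidate U z₀ f) {w : ℂ}
    (hw : w ∈ ball (0 : ℂ) 1) (hwf : w ∉ f '' U) :
    ∃ g, IsRiemannCandidate U z₀ g ∧ ‖deriv f z₀‖ < ‖deriv g z₀‖ := by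
  rw [mem_ball_zero_iff] at hw
  have hfn : ∀ z ∈ U, ‖f z‖ < 1 := fun z hz => mem_ball_zero_iff.1 (hf.mapsTo hz)
  have hden : ∀ z ∈ U, 1 - conj w * f z ≠ 0 := fun z hz =>
    one_sub_conj_mul_ne_zero hw (hfn z hz).le
  have hdf : ∀ z ∈ U, HasDerivAt f (deriv f z) z := fun z hz =>
    (hf.differentiableOn.differentiableAt (hUo.mem_nhds hz)).hasDerivAt
  have hh : ∀ z ∈ U, HasDerivAt (fun z => mob w (f z))
      ((1 - conj w * w) / (1 - conj w * f z) ^ 2 * deriv f z) z := fun z hz =>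
    (hasDerivAt_mob (hden z hz)).comp z (hdf z hz)
  have hh0 : ∀ z ∈ U, mob w (f z) ≠ 0 := fun z hz h => by
    rcases div_eq_zero_iff.1 h with h | h
    · exact hwf ⟨z, hz, sub_eq_zero.1 h⟩
    · exact hden z hz h
  -- Koebe's square-root trick: `mob w ∘ f` omits 0, so it has a root `q`, which another disk
  -- automorphism recentres at `z₀`.
  obtain ⟨q, hq, hdq⟩ := exists_analytic_sqrt hUo hUc
    (fun z hz => (hh z hz).differentiableAt.differentiableWithinAt) hh0
  have hq0 : ∀ z ∈ U, q z ≠ 0 := fun z hz h => hh0 z hz (by rw [← hq, h]; simp)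
  have hqn : ∀ z ∈ U, ‖q z‖ < 1 := fun z hz => by
    have : ‖q z‖ ^ 2 < 1 := by
      rw [← norm_pow, hq]; exact norm_mob_lt_one hw (hfn z hz)
    nlinarith [norm_nonneg (q z)]
  have hp := hqn z₀ hz₀
  have hdg : ∀ z ∈ U, HasDerivAt (fun z => mob (q z₀) (q z))
      ((1 - conj (q z₀) * q z₀) / (1 - conj (q z₀) * q z) ^ 2 *
        (((1 - conj w * w) / (1 - conj w * f z) ^ 2 * deriv f z) / (2 * q z))) z := fun z hz => by
    have := hdq z hz
    rw [(hh z hz).deriv] at this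
    exact (hasDerivAt_mob (one_sub_conj_mul_ne_zero hp (hqn z hz).le)).comp z this
  refine ⟨fun z => mob (q z₀) (q z), ⟨?_, ?_, ?_, ?_, ?_⟩, ?_⟩
  · exact fun z hz => (hdg z hz).differentiableAt.differentiableWithinAt
  · exact fun z hz => mem_ball_zero_iff.2 (norm_mob_lt_one hp (hqn z hz))
  · intro x hx y hy hxy
    have h1 : q x = q y := mob_injOn hp (mem_ball_zero_iff.2 (hqn x hx))
      (mem_ball_zero_iff.2 (hqn y hy)) hxy
    have h2 : mob w (f x) = mob w (f y) := by rw [← hq, ← hq, h1]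
    exact hf.injOn hx hy (mob_injOn hw (hf.mapsTo hx) (hf.mapsTo hy) h2)
  · intro z hz
    rw [(hdg z hz).deriv]
    have h1 := one_sub_conj_mul_ne_zero hp (hqn z hz).le
    have h2 := one_sub_conj_mul_self_ne_zero hp
    have h3 := one_sub_conj_mul_self_ne_zero hw
    have h4 := hf.deriv_ne z hz
    have h5 := hq0 z hz
    have h6 := hden z hz
    exact mul_ne_zero (div_ne_zero h2 (pow_ne_zero _ h1)) (div_ne_zero
      (mul_ne_zero (div_ne_zero h3 (pow_ne_zero _ h6)) h4) (mul_ne_zero two_ne_zero h5))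
  · simp [mob]
  · rw [(hdg z₀ hz₀).deriv, hf.map_base]
    have hfd : 0 < ‖deriv f z₀‖ := norm_pos_iff.2 (hf.deriv_ne z₀ hz₀)
    have hqw : ‖w‖ = ‖q z₀‖ ^ 2 := by
      rw [← norm_pow, hq, hf.map_base]; simp [mob]
    have hqpos : 0 < ‖q z₀‖ := norm_pos_iff.2 (hq0 z₀ hz₀)
    have key : ∀ u : ℂ, ‖u‖ < 1 → ‖1 - conj u * u‖ = 1 - ‖u‖ ^ 2 := fun u hu => by
      rw [← Complex.normSq_eq_conj_mul_self, Complex.normSq_eq_norm_sq, ← Complex.ofReal_one,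
        ← Complex.ofReal_sub, Complex.norm_real, Real.norm_of_nonneg]
      nlinarith [norm_nonneg u]
    simp only [norm_mul, norm_div, norm_pow, key _ hp, key _ hw, mul_zero, sub_zero,
      one_pow, div_one, hqw, Complex.norm_ofNat]
    set t := ‖q z₀‖
    have ht : 0 < 1 - t ^ 2 := by nlinarith
    have : (1 - t ^ 2) / (1 - t ^ 2) ^ 2 * ((1 - (t ^ 2) ^ 2) * ‖deriv f z₀‖ / (2 * t)) =
        (1 + t ^ 2) / (2 * t) * ‖deriv f z₀‖ := by
      field_simp
      ring
    rw [this]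
    -- The derivative at `z₀` grows by this factor, which exceeds 1 because `(1 - t) ^ 2 > 0`.
    have h1 : 1 < (1 + t ^ 2) / (2 * t) := by
      rw [lt_div_iff₀ (by positivity)]
      nlinarith [sq_pos_of_pos (sub_pos.2 hp)]
    nlinarith

/-- The derivative at the base point attains its maximum over all candidates. -/
lemma exists_isRiemannCandidate_max {U : Set ℂ} (hUo : IsOpen U) (hUc : IsPreconnected U)
    {z₀ : ℂ} (hz₀ : z₀ ∈ U) (hne : ∃ f, IsRiemannCandidate U z₀ f) :
    ∃ f, IsRiemannCandidate U z₀ f ∧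
      ∀ g, IsRiemannCandidate U z₀ g → ‖deriv g z₀‖ ≤ ‖deriv f z₀‖ := by
  obtain ⟨f₀, hf₀⟩ := hne
  obtain ⟨ρ, hρ, hball⟩ := Metric.isOpen_iff.1 hUo z₀ hz₀
  set S : Set ℝ := (fun f => ‖deriv f z₀‖) '' {f | IsRiemannCandidate U z₀ f} with hS
  have hcb : closedBall z₀ (ρ / 2) ⊆ U := (closedBall_subset_ball (by linarith)).trans hball
  have hbdd : BddAbove S := by
    refine ⟨1 / (ρ / 2), ?_⟩
    rintro _ ⟨f, hf : IsRiemannCandidate U z₀ f, rfl⟩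
    refine Complex.norm_deriv_le_of_forall_mem_sphere_norm_le (by positivity) ?_ ?_
    · refine DifferentiableOn.diffContOnCl ?_
      rw [closure_ball _ (by positivity)]
      exact hf.differentiableOn.mono hcb
    · exact fun u hu => (mem_ball_zero_iff.1 (hf.mapsTo (hcb (sphere_subset_closedBall hu)))).le
  have hSne : S.Nonempty := ⟨_, f₀, hf₀, rfl⟩
  obtain ⟨u, -, hu, huS⟩ := exists_seq_tendsto_sSup hSne hbdd
  choose F hF hFu using huS
  replace hF : ∀ n, IsRiemannCandidate U z₀ (F n) := hF
  obtain ⟨g, hg⟩ := exists_tendstoLocallyUniformlyOn_ultrafilter (hyperfilter ℕ) hUo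
    (fun n => (hF n).differentiableOn) (fun n => (hF n).mapsTo)
  have hgd : DifferentiableOn ℂ g U :=
    hg.differentiableOn (.of_forall fun n => (hF n).differentiableOn) hUo
  have hga : AnalyticOnNhd ℂ g U := hgd.analyticOnNhd hUo
  have hder := hg.deriv (.of_forall fun n => (hF n).differentiableOn) hUo
  have hsup : ‖deriv g z₀‖ = sSup S := by
    refine tendsto_nhds_unique (hder.tendsto_at hz₀).norm ?_
    refine (hu.mono_left (Nat.hyperfilter_le_atTop)).congr fun n => ?_
    exact (hFu n).symm
  have hle : ∀ h, IsRiemannCandidate U z₀ h → ‖deriv h z₀‖ ≤ ‖deriv g z₀‖ := fun h hh => by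
    rw [hsup]; exact le_csSup hbdd ⟨h, hh, rfl⟩
  have hpos : deriv g z₀ ≠ 0 :=
    norm_pos_iff.1 ((norm_pos_iff.2 (hf₀.deriv_ne z₀ hz₀)).trans_le (hle f₀ hf₀))
  -- The limit is nowhere locally constant, since its derivative at `z₀` dominates that of `f₀`.
  -- This excludes the degenerate alternative in Hurwitz's theorem and in the maximum principle.
  have hnc : ∀ z ∈ U, ∀ c, ¬ ∀ᶠ x in 𝓝 z, g x = c := by
    intro z hz c hc
    have := hga.eqOn_of_preconnected_of_eventuallyEq analyticOnNhd_const hUc hz hc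
    refine hpos ?_
    rw [(this.eventuallyEq_of_mem (hUo.mem_nhds hz₀)).deriv_eq]
    simp
  have hbase : g z₀ = 0 := by
    refine tendsto_nhds_unique (hg.tendsto_at hz₀) ?_
    exact tendsto_const_nhds.congr fun n => (hF n).map_base.symm
  refine ⟨g, ⟨hgd, ?_, ?_, ?_, hbase⟩, hle⟩
  · have hcl : ∀ z ∈ U, ‖g z‖ ≤ 1 := fun z hz =>
      le_of_tendsto (hg.tendsto_at hz).norm
        (.of_forall fun n => (mem_ball_zero_iff.1 ((hF n).mapsTo hz)).le)
    intro z hz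
    rw [mem_ball_zero_iff]
    refine lt_of_le_of_ne (hcl z hz) fun h1 => ?_
    have := Complex.eqOn_of_isPreconnected_of_isMaxOn_norm hUc hUo hgd hz
      (fun x hx => by simpa [h1] using hcl x hx)
    exact hnc z hz (g z) (this.eventuallyEq_of_mem (hUo.mem_nhds hz))
  · intro x hx y hy hxy
    by_contra hne
    -- Hurwitz's theorem is applied on `U` without `x`, where injectivity makes `F n - F n x`
    -- zero-free.
    have hlim : TendstoLocallyUniformlyOn (fun n z => F n z - F n x) (fun z => g z - g x)
        (hyperfilter ℕ : Filter ℕ) (U \ {x}) := by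
      rw [tendstoLocallyUniformlyOn_iff_forall_isCompact (hUo.sdiff isClosed_singleton)]
      intro K hK hKc
      have h1 := (tendstoLocallyUniformlyOn_iff_forall_isCompact hUo).1 hg K
        (hK.trans sdiff_subset) hKc
      have h2 : TendstoUniformlyOn (fun n (_ : ℂ) => F n x) (fun _ => g x)
          (hyperfilter ℕ : Filter ℕ) K := (hg.tendsto_at hx).tendstoUniformlyOn_const K
      exact h1.sub h2
    have := eventually_eq_zero_of_tendstoLocallyUniformlyOn (hUo.sdiff isClosed_singleton)
      (fun n => ((hF n).differentiableOn.mono sdiff_subset).sub_const _)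
      (fun n z hz h => hz.2 ((hF n).injOn hz.1 hx (sub_eq_zero.1 h))) hlim
      (z := y) ⟨hy, fun h => hne h.symm⟩ (by simp [hxy])
    exact hnc y hy (g x) (this.mono fun z hz => sub_eq_zero.1 hz)
  · intro z hz hz0
    have hev := eventually_eq_zero_of_tendstoLocallyUniformlyOn hUo
      (fun n => ((hF n).differentiableOn.deriv hUo)) (fun n => (hF n).deriv_ne) hder hz hz0
    have := (hga.deriv).eqOn_zero_of_preconnected_of_eventuallyEq_zero hUc hz hev
    exact hpos (this hz₀)

/-- The Riemann mapping theorem for bounded domains. -/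
theorem exists_biholo_ball {U : Set ℂ} (hUo : IsOpen U) (hUc : IsSimplyConnected U)
    (hUb : Bornology.IsBounded U) : ∃ φ ψ : ℂ → ℂ, Biholo φ ψ U (ball 0 1) := by
  obtain ⟨z₀, hz₀⟩ := hUc.nonempty
  obtain ⟨R, hR⟩ := hUb.subset_ball z₀
  have hRpos : 0 < R := by simpa using hR hz₀
  have hR0 : (R : ℂ) ≠ 0 := by exact_mod_cast hRpos.ne'
  -- Boundedness enters here: an affine map provides a first candidate.
  have hcand : IsRiemannCandidate U z₀ (fun z => (z - z₀) / R) := by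
    refine ⟨by fun_prop, fun z hz => ?_, fun x _ y _ h => ?_, fun z _ => ?_, by simp⟩
    · have := hR hz
      rw [mem_ball, dist_eq_norm] at this
      rw [mem_ball_zero_iff, norm_div, Complex.norm_real, Real.norm_of_nonneg hRpos.le,
        div_lt_one hRpos]
      exact this
    · simpa [div_left_inj' hR0] using h
    · simp [hR0]
  obtain ⟨φ, hφ, hmax⟩ := exists_isRiemannCandidate_max hUo
    hUc.isPathConnected.isConnected.isPreconnected hz₀ ⟨_, hcand⟩
  have hsurj : ∀ w ∈ ball (0 : ℂ) 1, w ∈ φ '' U := fun w hw => by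
    by_contra hwn
    obtain ⟨g, hg, hlt⟩ := hφ.exists_lt hUo hUc hz₀ hw hwn
    exact absurd (hmax g hg) (not_le.2 hlt)
  have hstrict : ∀ z ∈ U, HasStrictDerivAt φ (deriv φ z) z := fun z hz =>
    (hφ.differentiableOn.analyticAt (hUo.mem_nhds hz)).hasStrictDerivAt
  have hinv : ∀ z ∈ U, Function.invFunOn φ U (φ z) = z := fun z hz =>
    hφ.injOn.leftInvOn_invFunOn hz
  have hdiff : DifferentiableOn ℂ (Function.invFunOn φ U) (ball 0 1) := by
    intro w hw
    obtain ⟨z, hz, rfl⟩ := hsurj w hw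
    have := (hstrict z hz).to_local_left_inverse (hφ.deriv_ne z hz)
      (g := Function.invFunOn φ U) ((hUo.eventually_mem hz).mono fun x hx => hinv x hx)
    exact this.hasDerivAt.differentiableAt.differentiableWithinAt
  exact ⟨φ, Function.invFunOn φ U, hφ.differentiableOn.analyticOnNhd hUo,
    hdiff.analyticOnNhd isOpen_ball, hφ.mapsTo,
    fun w hw => Function.invFunOn_mem (hsurj w hw), hinv,
    fun w hw => Function.invFunOn_eq (hsurj w hw)⟩

end PolyLike

/-! ### Finite Blaschke products and their high sublevel sets. -/

namespace PolyLike

open Filter Topology ComplexConjugate Polynomial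

/-- Splitting off a zero of an analytic function. -/
lemma exists_eq_pow_mul {f : ℂ → ℂ} {U : Set ℂ} (hf : AnalyticOnNhd ℂ f U) {a : ℂ} (ha : a ∈ U)
    (hne : ¬ ∀ᶠ z in 𝓝 a, f z = 0) :
    ∃ (m : ℕ) (g : ℂ → ℂ), AnalyticOnNhd ℂ g U ∧ g a ≠ 0 ∧ ∀ z, z ∈ U → f z = (z - a) ^ m * g z := by
  classical
  obtain ⟨m, g, hg, hga, hfg⟩ := (hf a ha).exists_eventuallyEq_pow_smul_nonzero_iff.2 hne
  have hoff : ∀ z, z ≠ a → Function.update (fun z => f z / (z - a) ^ m) a (g a) z =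
      f z / (z - a) ^ m := fun z hz => Function.update_of_ne hz _ _
  refine ⟨m, Function.update (fun z => f z / (z - a) ^ m) a (g a), ?_, by simpa using hga, ?_⟩
  · intro z hz
    by_cases hza : z = a
    · subst hza
      refine hg.congr ?_
      filter_upwards [hfg] with x hx
      by_cases hxz : x = z
      · subst hxz; simp
      · rw [hoff x hxz, hx, smul_eq_mul, mul_div_cancel_left₀]
        exact pow_ne_zero _ (sub_ne_zero.2 hxz)
    · have h1 : AnalyticAt ℂ (fun z => f z / (z - a) ^ m) z :=
        (hf z hz).div (by fun_prop) (pow_ne_zero _ (sub_ne_zero.2 hza))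
      refine h1.congr ?_
      filter_upwards [isOpen_ne.mem_nhds hza] with x hx
      exact (hoff x hx).symm
  · intro z hz
    by_cases hza : z = a
    · subst hza
      simpa using hfg.self_of_nhds
    · rw [hoff z hza, mul_div_cancel₀]
      exact pow_ne_zero _ (sub_ne_zero.2 hza)

/-- Zeros are split off one point of `Z` at a time. `Z` need only contain the zeros, the exponent at
a point being allowed to vanish, so the quotient satisfies the hypotheses with the smaller set. -/
lemma exists_eq_prod_mul {U : Set ℂ} (hU : IsPreconnected U) (Z : Finset ℂ) :
    ∀ f : ℂ → ℂ, AnalyticOnNhd ℂ f U → (∃ z ∈ U, f z ≠ 0) → (∀ z ∈ U, f z = 0 → z ∈ Z) →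
      (∀ z ∈ Z, z ∈ U) →
      ∃ (s : Multiset ℂ) (g : ℂ → ℂ), (∀ a ∈ s, a ∈ U) ∧ AnalyticOnNhd ℂ g U ∧
        (∀ z ∈ U, g z ≠ 0) ∧ ∀ z ∈ U, f z = (s.map fun a => z - a).prod * g z := by
  induction Z using Finset.induction_on with
  | empty => exact fun f hf _ hz _ => ⟨0, f, by simp, hf, fun z hzU h => by simpa using hz z hzU h,
      by simp⟩
  | insert a Z haZ ih =>
    intro f hf hne hz hZU
    have haU : a ∈ U := hZU a (Finset.mem_insert_self _ _)
    obtain ⟨m, g, hg, hga, hfg⟩ := exists_eq_pow_mul hf haU fun h => by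
      obtain ⟨z, hzU, hz0⟩ := hne
      exact hz0 (hf.eqOn_zero_of_preconnected_of_eventuallyEq_zero hU haU h hzU)
    obtain ⟨s, g', hs, hg', hg0, hgg⟩ := ih g hg ⟨a, haU, hga⟩ (fun z hzU hgz => by
      have : z ∈ insert a Z := hz z hzU (by rw [hfg z hzU, hgz, mul_zero])
      refine (Finset.mem_insert.1 this).resolve_left ?_
      rintro rfl
      exact hga hgz) (fun z hzZ => hZU z (Finset.mem_insert_of_mem hzZ))
    refine ⟨Multiset.replicate m a + s, g', fun b hb => ?_, hg', hg0, fun z hzU => ?_⟩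
    · rcases Multiset.mem_add.1 hb with hb | hb
      · rw [Multiset.eq_of_mem_replicate hb]; exact haU
      · exact hs b hb
    · rw [hfg z hzU, hgg z hzU]
      simp [mul_assoc]

/-- The finite Blaschke product with zeros in the multiset `s`. -/
noncomputable def blaschke (s : Multiset ℂ) (z : ℂ) : ℂ := (s.map fun a => mob a z).prod

lemma multiset_prod_norm_le_of {s : Multiset ℂ} {f g : ℂ → ℂ} (h : ∀ a ∈ s, ‖f a‖ ≤ ‖g a‖) :
    ‖(s.map f).prod‖ ≤ ‖(s.map g).prod‖ := by
  induction s using Multiset.induction_on with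
  | empty => simp
  | cons a s ih =>
    simp only [Multiset.map_cons, Multiset.prod_cons, norm_mul]
    exact mul_le_mul (h a (by simp)) (ih fun b hb => h b (by simp [hb])) (norm_nonneg _)
      (norm_nonneg _)

lemma blaschke_eq_div (s : Multiset ℂ) (z : ℂ) :
    blaschke s z = (s.map fun a => z - a).prod / (s.map fun a => 1 - conj a * z).prod := by
  simp only [blaschke, mob, Multiset.prod_map_div]

lemma den_ne_zero {s : Multiset ℂ} (hs : ∀ a ∈ s, a ∈ ball (0 : ℂ) 1) {z : ℂ} (hz : ‖z‖ ≤ 1) :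
    (s.map fun a => 1 - conj a * z).prod ≠ 0 := by
  refine Multiset.prod_ne_zero fun h => ?_
  obtain ⟨a, ha, h0⟩ := Multiset.mem_map.1 h
  exact one_sub_conj_mul_ne_zero (mem_ball_zero_iff.1 (hs a ha)) hz h0

lemma differentiable_prod_sub (s : Multiset ℂ) :
    Differentiable ℂ fun z => (s.map fun a => z - a).prod := by
  induction s using Multiset.induction_on with
  | empty => simp
  | cons a s ih => simp only [Multiset.map_cons, Multiset.prod_cons]; fun_prop

lemma differentiable_den (s : Multiset ℂ) :
    Differentiable ℂ fun z => (s.map fun a => 1 - conj a * z).prod := by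
  induction s using Multiset.induction_on with
  | empty => simp
  | cons a s ih => simp only [Multiset.map_cons, Multiset.prod_cons]; fun_prop

lemma norm_sub_le_norm_den {a z : ℂ} (ha : ‖a‖ < 1) (hz : ‖z‖ ≤ 1) :
    ‖z - a‖ ≤ ‖1 - conj a * z‖ := by
  refine (pow_le_pow_iff_left₀ (norm_nonneg _) (norm_nonneg _) two_ne_zero).1 ?_
  have := norm_sq_one_sub_sub a z
  have h1 : 0 ≤ 1 - ‖a‖ ^ 2 := by nlinarith [norm_nonneg a]
  have h2 : 0 ≤ 1 - ‖z‖ ^ 2 := by nlinarith [norm_nonneg z]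
  nlinarith [mul_nonneg h1 h2]

lemma norm_den_le_norm_sub {a z : ℂ} (ha : ‖a‖ < 1) (hz : 1 ≤ ‖z‖) :
    ‖1 - conj a * z‖ ≤ ‖z - a‖ := by
  refine (pow_le_pow_iff_left₀ (norm_nonneg _) (norm_nonneg _) two_ne_zero).1 ?_
  have := norm_sq_one_sub_sub a z
  have h1 : 0 ≤ 1 - ‖a‖ ^ 2 := by nlinarith [norm_nonneg a]
  have h2 : 0 ≤ ‖z‖ ^ 2 - 1 := by nlinarith [norm_nonneg z]
  nlinarith [mul_nonneg h1 h2]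

lemma norm_blaschke_le_one {s : Multiset ℂ} (hs : ∀ a ∈ s, a ∈ ball (0 : ℂ) 1) {z : ℂ}
    (hz : ‖z‖ ≤ 1) : ‖blaschke s z‖ ≤ 1 := by
  rw [blaschke_eq_div, norm_div, div_le_one (norm_pos_iff.2 (den_ne_zero hs hz))]
  exact multiset_prod_norm_le_of fun a ha => norm_sub_le_norm_den (mem_ball_zero_iff.1 (hs a ha)) hz

lemma norm_blaschke_sphere {s : Multiset ℂ} (hs : ∀ a ∈ s, a ∈ ball (0 : ℂ) 1) {z : ℂ}
    (hz : ‖z‖ = 1) : ‖blaschke s z‖ = 1 := by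
  refine le_antisymm (norm_blaschke_le_one hs hz.le) ?_
  rw [blaschke_eq_div, norm_div, le_div_iff₀ (norm_pos_iff.2 (den_ne_zero hs hz.le)), one_mul]
  exact multiset_prod_norm_le_of fun a ha => norm_den_le_norm_sub (mem_ball_zero_iff.1 (hs a ha)) hz.ge

lemma continuousOn_blaschke {s : Multiset ℂ} (hs : ∀ a ∈ s, a ∈ ball (0 : ℂ) 1) :
    ContinuousOn (blaschke s) (closedBall 0 1) := by
  have : blaschke s = fun z => _ := funext (blaschke_eq_div s)
  rw [this]
  exact (differentiable_prod_sub s).continuous.continuousOn.div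
    (differentiable_den s).continuous.continuousOn
    fun z hz => den_ne_zero hs (mem_closedBall_zero_iff.1 hz)

/-- A proper analytic self-map of the unit disk has finitely many zeros. -/
lemma finite_zeros_of_proper {B : ℂ → ℂ} (hB : AnalyticOnNhd ℂ B (ball 0 1))
    (hp : IsProperOn B (ball 0 1) (ball 0 1)) :
    (∃ z ∈ ball (0 : ℂ) 1, B z ≠ 0) ∧ (ball (0 : ℂ) 1 ∩ B ⁻¹' {0}).Finite := by
  have hc := hp.isCompact_preimage {0} (by simp) isCompact_singleton
  have hne : ∃ z ∈ ball (0 : ℂ) 1, B z ≠ 0 := by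
    by_contra! h
    -- If `B` vanished identically, properness would make the open disk compact.
    have : ball (0 : ℂ) 1 ∩ B ⁻¹' {0} = ball 0 1 := inter_eq_left.2 fun z hz => h z hz
    rw [this] at hc
    have := hc.isClosed.closure_eq
    rw [closure_ball _ one_ne_zero] at this
    have h1 : (1 : ℂ) ∈ ball (0 : ℂ) 1 := this ▸ (by simp)
    simp at h1
  refine ⟨hne, ?_⟩
  by_contra hinf
  obtain ⟨x, hx, hacc⟩ := Set.Infinite.exists_accPt_of_subset_isCompact hinf hc subset_rfl
  rw [accPt_iff_frequently_nhdsNE] at hacc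
  obtain ⟨z, hz, hz0⟩ := hne
  exact hz0 (hB.eqOn_zero_of_preconnected_of_frequently_eq_zero
    (convex_ball _ _).isPreconnected hx.1 (hacc.mono fun y hy => hy.2) hz)

/-- The maximum principle on the unit disk. -/
lemma norm_le_of_annulus {g : ℂ → ℂ} (hg : AnalyticOnNhd ℂ g (ball 0 1))
    {C R : ℝ} (hR : R < 1)
    (hle : ∀ z ∈ ball (0 : ℂ) 1, R ≤ ‖z‖ → ‖g z‖ ≤ C) {z : ℂ} (hz : z ∈ ball (0 : ℂ) 1) :
    ‖g z‖ ≤ C := by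
  have hz1 := mem_ball_zero_iff.1 hz
  obtain ⟨ρ, h1, h2⟩ := exists_between (max_lt (max_lt hR hz1) (zero_lt_one' ℝ))
  have hρ : 0 < ρ := (le_max_right _ _).trans_lt h1
  have hRρ : R < ρ := ((le_max_left _ _).trans (le_max_left _ _)).trans_lt h1
  have hzρ : ‖z‖ < ρ := ((le_max_right _ _).trans (le_max_left _ _)).trans_lt h1
  have hsub : closedBall (0 : ℂ) ρ ⊆ ball 0 1 := closedBall_subset_ball h2
  refine Complex.norm_le_of_forall_mem_frontier_norm_le (isBounded_ball (x := (0 : ℂ)) (r := ρ))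
    ?_ (fun x hx => ?_) (subset_closure (mem_ball_zero_iff.2 hzρ))
  · refine DifferentiableOn.diffContOnCl ?_
    rw [closure_ball _ hρ.ne']
    exact hg.differentiableOn.mono hsub
  · rw [frontier_ball _ hρ.ne'] at hx
    exact hle x (hsub (sphere_subset_closedBall hx)) (by
      rw [mem_sphere_zero_iff_norm.1 hx]; exact hRρ.le)

/-- A proper analytic self-map of the unit disk is a finite Blaschke product. -/
theorem exists_eq_blaschke {B : ℂ → ℂ} (hB : AnalyticOnNhd ℂ B (ball 0 1))
    (hp : IsProperOn B (ball 0 1) (ball 0 1)) :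
    ∃ (s : Multiset ℂ) (c : ℂ), (∀ a ∈ s, a ∈ ball (0 : ℂ) 1) ∧ ‖c‖ = 1 ∧
      ∀ z ∈ ball (0 : ℂ) 1, B z = c * blaschke s z := by
  have hconn : IsPreconnected (ball (0 : ℂ) 1) := (convex_ball _ _).isPreconnected
  obtain ⟨hne, hfin⟩ := finite_zeros_of_proper hB hp
  obtain ⟨s, g, hs, hg, hg0, hBg⟩ := exists_eq_prod_mul hconn hfin.toFinset B hB hne
    (fun z hz h => by simpa using ⟨mem_ball_zero_iff.1 hz, h⟩)
    (fun z hz => ((hfin.mem_toFinset).1 hz).1)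
  -- `G` is `B` divided by the Blaschke product with the same zeros, written so that it has no
  -- singularities. It will turn out to be unimodular, hence constant.
  set G : ℂ → ℂ := fun z => g z * (s.map fun a => 1 - conj a * z).prod with hG
  have hGa : AnalyticOnNhd ℂ G (ball 0 1) := hg.mul fun z _ => (differentiable_den s).analyticAt z
  have hden : ∀ z ∈ ball (0 : ℂ) 1, (s.map fun a => 1 - conj a * z).prod ≠ 0 := fun z hz =>
    den_ne_zero hs (mem_ball_zero_iff.1 hz).le
  have hG0 : ∀ z ∈ ball (0 : ℂ) 1, G z ≠ 0 := fun z hz => mul_ne_zero (hg0 z hz) (hden z hz)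
  have hBG : ∀ z ∈ ball (0 : ℂ) 1, B z = G z * blaschke s z := fun z hz => by
    rw [hBg z hz, blaschke_eq_div, hG, mul_assoc, mul_div_cancel₀ _ (hden z hz), mul_comm]
  -- Both moduli tend to 1 at the circle: for `B` by properness, for the Blaschke product by
  -- continuity up to the boundary. The maximum principle for `G` and `G⁻¹` then gives bounds `1 /
  -- t` for every `t < 1`.
  have hann : ∀ t : ℝ, 0 < t → t < 1 → ∃ R < 1, ∀ z ∈ ball (0 : ℂ) 1, R ≤ ‖z‖ →
      t ≤ ‖B z‖ ∧ t ≤ ‖blaschke s z‖ := by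
    intro t ht ht1
    have h1 := hp.isCompact_preimage (closedBall 0 t) (closedBall_subset_ball ht1)
      (isCompact_closedBall _ _)
    have h2 : IsClosed (closedBall (0 : ℂ) 1 ∩ blaschke s ⁻¹' closedBall 0 t) :=
      (continuousOn_blaschke hs).preimage_isClosed_of_isClosed isClosed_closedBall
        isClosed_closedBall
    have h3 : closedBall (0 : ℂ) 1 ∩ blaschke s ⁻¹' closedBall 0 t ⊆ ball 0 1 := by
      rintro z ⟨hz, hzt⟩
      rw [mem_closedBall_zero_iff] at hz
      rw [mem_preimage, mem_closedBall_zero_iff] at hzt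
      refine mem_ball_zero_iff.2 (lt_of_le_of_ne hz fun h => ?_)
      rw [norm_blaschke_sphere hs h] at hzt
      linarith
    obtain ⟨R₁, hR₁, hs₁⟩ := exists_lt_subset_ball h1.isClosed inter_subset_left
    obtain ⟨R₂, hR₂, hs₂⟩ := exists_lt_subset_ball h2 h3
    refine ⟨max R₁ R₂, max_lt hR₁ hR₂, fun z hz hRz => ⟨?_, ?_⟩⟩
    · by_contra! h
      have := mem_ball_zero_iff.1 (hs₁ ⟨hz, by simpa using h.le⟩)
      exact absurd (this.trans_le (le_max_left _ _)) (not_lt.2 hRz)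
    · by_contra! h
      have := mem_ball_zero_iff.1 (hs₂ ⟨ball_subset_closedBall hz, by simpa using h.le⟩)
      exact absurd (this.trans_le (le_max_right _ _)) (not_lt.2 hRz)
  have hGbd : ∀ z ∈ ball (0 : ℂ) 1, ∀ t : ℝ, 0 < t → t < 1 → ‖G z‖ ≤ 1 / t ∧ ‖(G z)⁻¹‖ ≤ 1 / t := by
    intro z hz t ht ht1
    obtain ⟨R, hR, hRt⟩ := hann t ht ht1
    constructor
    · refine norm_le_of_annulus hGa hR (fun x hx hRx => ?_) hz
      obtain ⟨-, h2⟩ := hRt x hx hRx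
      have h3 : ‖B x‖ < 1 := mem_ball_zero_iff.1 (hp.mapsTo hx)
      rw [hBG x hx, norm_mul] at h3
      rw [le_div_iff₀ ht]
      nlinarith [norm_nonneg (G x)]
    · refine norm_le_of_annulus (hGa.inv hG0) hR (fun x hx hRx => ?_) hz
      obtain ⟨h1, -⟩ := hRt x hx hRx
      have h2 := norm_blaschke_le_one hs (mem_ball_zero_iff.1 hx).le
      rw [hBG x hx, norm_mul] at h1
      rw [Pi.inv_apply, norm_inv, inv_le_comm₀ (norm_pos_iff.2 (hG0 x hx)) (by positivity), one_div,
        inv_inv]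
      nlinarith [norm_nonneg (G x)]
  have hle1 : ∀ x : ℝ, (∀ t : ℝ, 0 < t → t < 1 → x ≤ 1 / t) → x ≤ 1 := by
    intro x hx
    by_contra! h
    obtain ⟨t, h1, h2⟩ := exists_between (inv_lt_one_of_one_lt₀ h)
    have ht : 0 < t := (by positivity : (0 : ℝ) < x⁻¹).trans h1
    have h3 := hx t ht h2
    rw [le_div_iff₀ ht] at h3
    have h4 : 1 < x * t := by
      have := mul_lt_mul_of_pos_left h1 (by positivity : 0 < x)
      rwa [mul_inv_cancel₀ (by positivity)] at this
    linarith
  have hG1 : ∀ z ∈ ball (0 : ℂ) 1, ‖G z‖ = 1 := fun z hz => by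
    refine le_antisymm (hle1 _ fun t h h' => (hGbd z hz t h h').1) ?_
    have := hle1 _ fun t h h' => (hGbd z hz t h h').2
    rwa [norm_inv, inv_le_one₀ (norm_pos_iff.2 (hG0 z hz))] at this
  have h0 : (0 : ℂ) ∈ ball (0 : ℂ) 1 := by simp
  refine ⟨s, G 0, hs, hG1 0 h0, fun z hz => ?_⟩
  have := Complex.eqOn_of_isPreconnected_of_isMaxOn_norm hconn isOpen_ball hGa.differentiableOn h0
    (fun x hx => by simp [hG1 x hx, hG1 0 h0]) hz
  rw [hBG z hz, this]
  rfl

/-- The pseudo-hyperbolic distance to `a` does not increase when a point moves radially inward, as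
long as its modulus stays at least `‖a‖`. -/
lemma norm_mob_smul_le {a y : ℂ} (ha : ‖a‖ < 1) (hy : ‖y‖ < 1) {t : ℝ} (ht0 : 0 ≤ t) (ht1 : t ≤ 1)
    (hat : ‖a‖ ≤ t * ‖y‖) : ‖mob a (t * y)‖ ≤ ‖mob a y‖ := by
  have hty : ‖(t : ℂ) * y‖ = t * ‖y‖ := by
    rw [norm_mul, Complex.norm_real, Real.norm_of_nonneg ht0]
  have hty1 : ‖(t : ℂ) * y‖ ≤ 1 := by rw [hty]; nlinarith [norm_nonneg y]
  rw [mob, mob, norm_div, norm_div, div_le_div_iff₀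
    (norm_pos_iff.2 (one_sub_conj_mul_ne_zero ha hty1))
    (norm_pos_iff.2 (one_sub_conj_mul_ne_zero ha hy.le))]
  refine (pow_le_pow_iff_left₀ (by positivity) (by positivity) two_ne_zero).1 ?_
  have e1 := norm_sq_one_sub_sub a y
  have e2 := norm_sq_one_sub_sub a (t * y)
  set c : ℝ := (conj a * y).re with hc
  have hcle : c ≤ ‖a‖ * ‖y‖ := by
    refine (Complex.re_le_norm _).trans ?_
    rw [norm_mul, RCLike.norm_conj]
  have e3 : ‖1 - conj a * y‖ ^ 2 = 1 - 2 * c + ‖a‖ ^ 2 * ‖y‖ ^ 2 := by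
    simp only [hc, Complex.sq_norm, Complex.normSq_apply, Complex.sub_re, Complex.sub_im,
      Complex.one_re, Complex.one_im, Complex.mul_re, Complex.mul_im, Complex.conj_re,
      Complex.conj_im]
    ring
  have e4 : ‖1 - conj a * (t * y)‖ ^ 2 = 1 - 2 * (t * c) + ‖a‖ ^ 2 * (t * ‖y‖) ^ 2 := by
    rw [mul_pow]
    simp only [hc, Complex.sq_norm, Complex.normSq_apply, Complex.sub_re, Complex.sub_im,
      Complex.one_re, Complex.one_im, Complex.mul_re, Complex.mul_im, Complex.conj_re,
      Complex.conj_im, Complex.ofReal_re, Complex.ofReal_im]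
    ring
  rw [hty] at e2
  rw [mul_pow, mul_pow]
  have f1 : ‖y - a‖ ^ 2 = ‖1 - conj a * y‖ ^ 2 - (1 - ‖a‖ ^ 2) * (1 - ‖y‖ ^ 2) := by linarith
  have f2 : ‖t * y - a‖ ^ 2 = ‖1 - conj a * (t * y)‖ ^ 2 - (1 - ‖a‖ ^ 2) * (1 - (t * ‖y‖) ^ 2) := by
    linarith
  rw [f1, f2, e3, e4]
  set α := ‖a‖
  set ρ := ‖y‖
  have hα : 0 ≤ α := norm_nonneg a
  have hρ : 0 ≤ ρ := norm_nonneg y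
  have hA : 0 ≤ 1 - α ^ 2 := by nlinarith
  have hαρ : α ≤ ρ := hat.trans (by nlinarith)
  -- the difference of both sides is a product of nonnegative factors
  have key : 0 ≤ (1 - t) * ((t * ρ + ρ) * ρ * (1 + α ^ 2) - 2 * c * (1 + t * ρ * ρ)) := by
    refine mul_nonneg (by linarith) ?_
    -- The worst case is `c = α * ρ`, with `a` and `y` on one ray; there the bracket equals `ρ`
    -- times the sum of the two products below.
    have h1 : 0 ≤ (t * ρ - α) * (1 - α * ρ) :=
      mul_nonneg (by linarith) (by nlinarith)
    have h2 : 0 ≤ (ρ - α) * (1 - α * (t * ρ)) :=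
      mul_nonneg (by linarith) (by nlinarith [mul_nonneg hα hρ])
    have h3 : 2 * c * (1 + t * ρ * ρ) ≤ 2 * (α * ρ) * (1 + t * ρ * ρ) := by
      have : 0 ≤ 1 + t * ρ * ρ := by positivity
      nlinarith
    nlinarith [mul_nonneg hρ (add_nonneg h1 h2)]
  nlinarith [mul_nonneg hA key]

/-- High sublevel sets of a finite Blaschke product are star-shaped. -/
lemma exists_starConvex_sublevel {B : ℂ → ℂ} (hB : AnalyticOnNhd ℂ B (ball 0 1))
    (hp : IsProperOn B (ball 0 1) (ball 0 1)) :
    ∃ s₀ : ℝ, s₀ < 1 ∧ ∀ s, s₀ < s → StarConvex ℝ 0 (ball 0 1 ∩ B ⁻¹' ball 0 s) ∧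
      (0 : ℂ) ∈ ball 0 1 ∩ B ⁻¹' ball 0 s := by
  obtain ⟨S, c, hS, hc, hBS⟩ := exists_eq_blaschke hB hp
  obtain ⟨R, hR, hSR⟩ := exists_lt_subset_ball (s := (S.toFinset : Set ℂ))
    S.toFinset.finite_toSet.isClosed (fun a ha => hS a (by simpa using ha))
  have hR1 : max R 0 < 1 := max_lt hR one_pos
  have hsub : closedBall (0 : ℂ) (max R 0) ⊆ ball 0 1 := closedBall_subset_ball hR1
  obtain ⟨x, hx, hmax⟩ := (isCompact_closedBall (0 : ℂ) (max R 0)).exists_isMaxOn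
    ⟨0, by simp⟩ (hB.continuousOn.mono hsub).norm
  -- The threshold is the maximum of `‖B‖` on a disk containing all zeros. A radius stays below `s`
  -- inside this disk, and outside it every Blaschke factor decreases inward. The `max` with 0 keeps
  -- the disk nonempty when `R` is negative.
  refine ⟨‖B x‖, mem_ball_zero_iff.1 (hp.mapsTo (hsub hx)), fun s hs => ⟨?_, ?_⟩⟩
  · rw [starConvex_zero_iff]
    rintro y ⟨hy, hys⟩ t ht0 ht1
    have hy1 := mem_ball_zero_iff.1 hy
    have hty : ‖(t : ℂ) * y‖ = t * ‖y‖ := by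
      rw [norm_mul, Complex.norm_real, Real.norm_of_nonneg ht0]
    have htb : (t : ℂ) * y ∈ ball (0 : ℂ) 1 := by
      rw [mem_ball_zero_iff, hty]; nlinarith [norm_nonneg y]
    rw [Complex.real_smul]
    refine ⟨htb, ?_⟩
    rw [mem_preimage, mem_ball_zero_iff] at hys ⊢
    by_cases hsm : t * ‖y‖ ≤ max R 0
    · exact (hmax (mem_closedBall_zero_iff.2 (hty.trans_le hsm))).trans_lt hs
    · push Not at hsm
      refine lt_of_le_of_lt ?_ hys
      rw [hBS _ htb, hBS _ hy, norm_mul, norm_mul, hc, one_mul, one_mul]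
      refine multiset_prod_norm_le_of fun a ha => norm_mob_smul_le (mem_ball_zero_iff.1 (hS a ha))
        hy1 ht0 ht1 ?_
      have := mem_ball_zero_iff.1 (hSR (show a ∈ (S.toFinset : Set ℂ) by simpa using ha))
      exact (this.trans_le (le_max_left _ _)).le.trans hsm.le
  · refine ⟨by simp, ?_⟩
    rw [mem_preimage, mem_ball_zero_iff]
    exact (hmax (by simp)).trans_lt hs

end PolyLike

/-! ### The degree of a proper map. -/

namespace PolyLike

open Filter Topology ComplexConjugate Polynomial

/-- The polynomial `c ∏ (X - a) - w ∏ (1 - conj a X)` whose roots solve `c * blaschke s z = w`. -/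
noncomputable def blaschkePoly (s : Multiset ℂ) (c w : ℂ) : ℂ[X] :=
  C c * (s.map fun a => X - C a).prod - C w * (s.map fun a => C 1 - C (conj a) * X).prod

lemma eval_blaschkePoly (s : Multiset ℂ) (c w z : ℂ) :
    (blaschkePoly s c w).eval z =
      c * (s.map fun a => z - a).prod - w * (s.map fun a => 1 - conj a * z).prod := by
  simp [blaschkePoly, eval_multiset_prod, Multiset.map_map]

lemma natDegree_one_sub_le (a : ℂ) : (C 1 - C (conj a) * X : ℂ[X]).natDegree ≤ 1 := by
  compute_degree

/-- The top coefficient is `c` minus `w` times a product of numbers of modulus below 1; it cannot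
vanish as `‖w‖ < 1 = ‖c‖`. -/
lemma natDegree_blaschkePoly {s : Multiset ℂ} (hs : ∀ a ∈ s, a ∈ ball (0 : ℂ) 1) {c w : ℂ}
    (hc : ‖c‖ = 1) (hw : ‖w‖ < 1) :
    (blaschkePoly s c w).natDegree = Multiset.card s ∧ blaschkePoly s c w ≠ 0 := by
  have h1 : ((s.map fun a => X - C a).prod : ℂ[X]).natDegree = Multiset.card s :=
    natDegree_multiset_prod_X_sub_C_eq_card s
  have h1m : ((s.map fun a => X - C a).prod : ℂ[X]).Monic := monic_multisetProd_X_sub_C s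
  have h2 : ((s.map fun a => C 1 - C (conj a) * X).prod : ℂ[X]).natDegree ≤ Multiset.card s := by
    refine (natDegree_multiset_prod_le _).trans ?_
    rw [Multiset.map_map]
    refine (Multiset.sum_le_card_nsmul _ 1 fun x hx => ?_).trans (by simp)
    obtain ⟨a, -, rfl⟩ := Multiset.mem_map.1 hx
    exact natDegree_one_sub_le a
  have hco : ((s.map fun a => C 1 - C (conj a) * X).prod : ℂ[X]).coeff (Multiset.card s) =
      (s.map fun a => - conj a).prod := by
    have := coeff_multiset_prod_of_natDegree_le
      (s.map fun a => (C 1 - C (conj a) * X : ℂ[X])) 1 (by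
        intro p hp
        obtain ⟨a, -, rfl⟩ := Multiset.mem_map.1 hp
        exact natDegree_one_sub_le a)
    rw [Multiset.card_map, mul_one, Multiset.map_map] at this
    rw [this]
    congr 1
    refine Multiset.map_congr rfl fun a _ => ?_
    simp [coeff_one]
  have hn : ‖(s.map fun a => - conj a).prod‖ ≤ 1 := by
    have := multiset_prod_norm_le_of (s := s) (f := fun a => - conj a) (g := fun _ => 1)
      (fun a ha => by simpa using (mem_ball_zero_iff.1 (hs a ha)).le)
    simpa using this
  have hcoeff : (blaschkePoly s c w).coeff (Multiset.card s) ≠ 0 := by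
    rw [blaschkePoly, coeff_sub, coeff_C_mul, coeff_C_mul, hco]
    have h3 : ((s.map fun a => X - C a).prod : ℂ[X]).coeff (Multiset.card s) = 1 := by
      rw [← h1]; exact h1m
    rw [h3, mul_one]
    intro h
    have h4 : ‖c‖ = ‖w‖ * ‖(s.map fun a => - conj a).prod‖ := by
      rw [← norm_mul, sub_eq_zero.1 h]
    nlinarith [norm_nonneg w]
  refine ⟨le_antisymm ?_ (le_natDegree_of_ne_zero hcoeff), fun h => hcoeff (by rw [h]; simp)⟩
  refine (natDegree_sub_le _ _).trans (max_le ?_ ?_)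
  · exact (natDegree_C_mul_le _ _).trans h1.le
  · exact (natDegree_C_mul_le _ _).trans h2

/-- Off the open disk each factor `1 - conj a * z` is at most `z - a` in modulus, so the term with
`c` outweighs the term with `w`. -/
lemma norm_lt_one_of_isRoot_blaschkePoly {s : Multiset ℂ} (hs : ∀ a ∈ s, a ∈ ball (0 : ℂ) 1)
    {c w z : ℂ} (hc : ‖c‖ = 1) (hw : ‖w‖ < 1) (hz : (blaschkePoly s c w).eval z = 0) : ‖z‖ < 1 := by
  by_contra! h
  rw [eval_blaschkePoly] at hz
  have h1 : ‖(s.map fun a => 1 - conj a * z).prod‖ ≤ ‖(s.map fun a => z - a).prod‖ :=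
    multiset_prod_norm_le_of fun a ha => norm_den_le_norm_sub (mem_ball_zero_iff.1 (hs a ha)) h
  have h2 : 0 < ‖(s.map fun a => z - a).prod‖ := by
    refine norm_pos_iff.2 (Multiset.prod_ne_zero fun h0 => ?_)
    obtain ⟨a, ha, h0⟩ := Multiset.mem_map.1 h0
    have := mem_ball_zero_iff.1 (hs a ha)
    rw [← sub_eq_zero.1 h0] at this
    linarith
  have h3 : ‖(s.map fun a => z - a).prod‖ = ‖w‖ * ‖(s.map fun a => 1 - conj a * z).prod‖ := by
    rw [← norm_mul, ← sub_eq_zero.1 hz, norm_mul, hc, one_mul]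
  nlinarith [norm_nonneg w]

/-- The vanishing order of a polynomial times a non-vanishing function. -/
lemma analyticOrderNatAt_eval_mul {p : ℂ[X]} (hp : p ≠ 0) {g f : ℂ → ℂ} {z : ℂ}
    (hg : AnalyticAt ℂ g z) (hgz : g z ≠ 0) (hf : ∀ᶠ x in 𝓝 z, f x = p.eval x * g x) :
    analyticOrderNatAt f z = p.rootMultiplicity z := by
  obtain ⟨q, hq, hqz⟩ := exists_eq_pow_rootMultiplicity_mul_and_not_dvd p hp z
  have hqz0 : q.eval z ≠ 0 := fun h => hqz (dvd_iff_isRoot.2 h)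
  have hfa : AnalyticAt ℂ f z := by
    refine AnalyticAt.congr ?_ (hf.mono fun x hx => hx.symm)
    exact (p.differentiable.analyticAt z).mul hg
  have : analyticOrderAt f z = (p.rootMultiplicity z : ℕ) := by
    rw [hfa.analyticOrderAt_eq_natCast]
    refine ⟨fun x => q.eval x * g x, (q.differentiable.analyticAt z).mul hg,
      mul_ne_zero hqz0 hgz, ?_⟩
    filter_upwards [hf] with x hx
    rw [hx]
    conv_lhs => rw [hq]
    simp [mul_assoc]
  rw [analyticOrderNatAt, this, ENat.toNat_natCast]

/-- A proper analytic self-map of the unit disk has a degree. -/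
theorem exists_hasDegreeOn_ball {B : ℂ → ℂ} (hB : AnalyticOnNhd ℂ B (ball 0 1))
    (hp : IsProperOn B (ball 0 1) (ball 0 1)) : ∃ n, HasDegreeOn B (ball 0 1) (ball 0 1) n := by
  classical
  obtain ⟨s, c, hs, hc, hBs⟩ := exists_eq_blaschke hB hp
  refine ⟨Multiset.card s, fun w hw => ?_⟩
  rw [mem_ball_zero_iff] at hw
  obtain ⟨hdeg, hne⟩ := natDegree_blaschkePoly hs hc hw
  have hBp : ∀ z ∈ ball (0 : ℂ) 1, B z - w =
      (blaschkePoly s c w).eval z * ((s.map fun a => 1 - conj a * z).prod)⁻¹ := fun z hz => by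
    have h := den_ne_zero hs (mem_ball_zero_iff.1 hz).le
    rw [hBs z hz, blaschke_eq_div, eval_blaschkePoly, ← div_eq_mul_inv, eq_div_iff h, sub_mul,
      mul_assoc, div_mul_cancel₀ _ h]
  have hset : ball (0 : ℂ) 1 ∩ B ⁻¹' {w} = ((blaschkePoly s c w).roots.toFinset : Set ℂ) := by
    ext z
    simp only [mem_inter_iff, mem_preimage, mem_singleton_iff, Finset.mem_coe,
      Multiset.mem_toFinset, mem_roots hne, IsRoot.def]
    constructor
    · rintro ⟨hz, hzw⟩
      have := hBp z hz
      rw [hzw, sub_self] at this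
      exact (mul_eq_zero.1 this.symm).resolve_right
        (inv_ne_zero (den_ne_zero hs (mem_ball_zero_iff.1 hz).le))
    · intro hz
      have hzb : z ∈ ball (0 : ℂ) 1 :=
        mem_ball_zero_iff.2 (norm_lt_one_of_isRoot_blaschkePoly hs hc hw hz)
      exact ⟨hzb, sub_eq_zero.1 (by rw [hBp z hzb, hz, zero_mul])⟩
  refine ⟨hset ▸ Finset.finite_toSet _, ?_⟩
  -- The count with multiplicity is the number of roots of a polynomial whose degree does not depend
  -- on `w`.
  rw [hset, finsum_mem_coe_finset, ← hdeg, ← IsAlgClosed.card_roots_eq_natDegree,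
    ← Multiset.toFinset_sum_count_eq]
  refine Finset.sum_congr rfl fun z hz => ?_
  rw [count_roots]
  have hzb : z ∈ ball (0 : ℂ) 1 := by
    have : z ∈ ball (0 : ℂ) 1 ∩ B ⁻¹' {w} := by rw [hset]; exact hz
    exact this.1
  have hd := den_ne_zero hs (mem_ball_zero_iff.1 hzb).le
  exact analyticOrderNatAt_eval_mul hne
    (((differentiable_den s).analyticAt z).inv hd) (inv_ne_zero hd)
    ((isOpen_ball.eventually_mem hzb).mono hBp)

lemma Biholo.symm {φ ψ : ℂ → ℂ} {X Y : Set ℂ} (h : Biholo φ ψ X Y) : Biholo ψ φ Y X :=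
  ⟨h.analytic_inv, h.analytic, h.mapsTo_inv, h.mapsTo, h.right_inv, h.left_inv⟩

lemma Biholo.deriv_ne {φ ψ : ℂ → ℂ} {X Y : Set ℂ} (h : Biholo φ ψ X Y) (hX : IsOpen X) {x : ℂ}
    (hx : x ∈ X) : deriv φ x ≠ 0 := by
  intro h0
  have h1 := (h.analytic x hx).differentiableAt.hasDerivAt
  have h2 := (h.analytic_inv _ (h.mapsTo hx)).differentiableAt.hasDerivAt
  have h3 : HasDerivAt (ψ ∘ φ) 1 x :=
    (hasDerivAt_id x).congr_of_eventuallyEq ((hX.eventually_mem hx).mono h.left_inv)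
  have := (h2.comp x h1).unique h3
  simp [h0] at this

/-- The restriction of a biholomorphic map as a homeomorphism. -/
noncomputable def Biholo.homeomorph {φ ψ : ℂ → ℂ} {X Y : Set ℂ} (h : Biholo φ ψ X Y) : X ≃ₜ Y where
  toFun := h.mapsTo.restrict
  invFun := h.mapsTo_inv.restrict
  left_inv x := Subtype.ext (h.left_inv x x.2)
  right_inv y := Subtype.ext (h.right_inv y y.2)
  continuous_toFun := h.analytic.continuousOn.mapsToRestrict h.mapsTo
  continuous_invFun := h.analytic_inv.continuousOn.mapsToRestrict h.mapsTo_inv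

lemma Biholo.isCompact_image {φ ψ : ℂ → ℂ} {X Y : Set ℂ} (h : Biholo φ ψ X Y) {C : Set ℂ}
    (hC : IsCompact C) (hCX : C ⊆ X) : IsCompact (φ '' C) :=
  hC.image_of_continuousOn (h.analytic.continuousOn.mono hCX)

/-- Properness of the conjugate of a proper map by biholomorphic maps. -/
lemma IsProperOn.conj {φ ψ φ' ψ' f : ℂ → ℂ} {X X' Y Y' : Set ℂ} (hX : Biholo φ ψ X X')
    (hY : Biholo φ' ψ' Y Y') (hf : IsProperOn f X Y) :
    IsProperOn (fun z => φ' (f (ψ z))) X' Y' := by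
  refine ⟨fun z hz => hY.mapsTo (hf.mapsTo (hX.mapsTo_inv hz)), fun C hCY hC => ?_⟩
  have h1 := hf.isCompact_preimage (ψ' '' C) (image_subset_iff.2 fun y hy => hY.mapsTo_inv (hCY hy))
    (hY.symm.isCompact_image hC hCY)
  have h2 := hX.isCompact_image h1 inter_subset_left
  convert h2 using 1
  ext z
  constructor
  · rintro ⟨hz, hzC⟩
    exact ⟨ψ z, ⟨hX.mapsTo_inv hz, _, hzC, hY.left_inv _ (hf.mapsTo (hX.mapsTo_inv hz))⟩,
      hX.right_inv z hz⟩
  · rintro ⟨x, ⟨hx, y, hy, hyx⟩, rfl⟩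
    refine ⟨hX.mapsTo hx, ?_⟩
    rw [mem_preimage, hX.left_inv x hx, ← hyx, hY.right_inv y (hCY hy)]
    exact hy

/-- Biholomorphic maps have non-vanishing derivative, so passing to Riemann coordinates preserves
vanishing orders as well as fibres. -/
lemma HasDegreeOn.of_conj {φ ψ φ' ψ' f : ℂ → ℂ} {X X' Y Y' : Set ℂ} (hX : Biholo φ ψ X X')
    (hXo : IsOpen X') (hY : Biholo φ' ψ' Y Y') (hYo : IsOpen Y) (hf : AnalyticOnNhd ℂ f X)
    (hfm : MapsTo f X Y) {n : ℕ} (hd : HasDegreeOn (fun z => φ' (f (ψ z))) X' Y' n) :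
    HasDegreeOn f X Y n := by
  intro w hw
  obtain ⟨hfin, hsum⟩ := hd (φ' w) (hY.mapsTo hw)
  have hbij : BijOn ψ (X' ∩ (fun z => φ' (f (ψ z))) ⁻¹' {φ' w}) (X ∩ f ⁻¹' {w}) := by
    refine ⟨?_, ?_, ?_⟩
    · rintro z ⟨hz, hzw⟩
      refine ⟨hX.mapsTo_inv hz, ?_⟩
      have := congrArg ψ' (show φ' (f (ψ z)) = φ' w from hzw)
      rwa [hY.left_inv _ (hfm (hX.mapsTo_inv hz)), hY.left_inv _ hw] at this
    · intro x hx y hy hxy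
      rw [← hX.right_inv x hx.1, hxy, hX.right_inv y hy.1]
    · rintro x ⟨hx, hxw⟩
      refine ⟨φ x, ⟨hX.mapsTo hx, ?_⟩, hX.left_inv x hx⟩
      simp only [mem_preimage, mem_singleton_iff] at hxw ⊢
      rw [hX.left_inv x hx, hxw]
  refine ⟨hbij.image_eq ▸ hfin.image ψ, ?_⟩
  rw [← hsum]
  refine (finsum_mem_eq_of_bijOn ψ hbij ?_).symm
  rintro z ⟨hz, hzw⟩
  have hfz : f (ψ z) = w := (hbij.1 ⟨hz, hzw⟩).2
  have hψ := hX.analytic_inv z hz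
  have hfψ : AnalyticAt ℂ f (ψ z) := hf _ (hX.mapsTo_inv hz)
  have hφ' : AnalyticAt ℂ φ' w := hY.analytic w hw
  have e1 : analyticOrderAt (fun ζ => φ' (f (ψ ζ)) - φ' w) z =
      analyticOrderAt (fun ζ => φ' ζ - φ' w) w * analyticOrderAt (fun ζ => f (ψ ζ) - w) z := by
    have h := AnalyticAt.analyticOrderAt_comp (f := fun ζ => φ' ζ - φ' w) (g := fun ζ => f (ψ ζ))
      (z₀ := z) (by simp only [hfz]; fun_prop) (hfψ.comp hψ)
    simpa only [hfz, Function.comp_def] using h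
  have e2 : analyticOrderAt (fun ζ => φ' ζ - φ' w) w = 1 :=
    hφ'.analyticOrderAt_sub_eq_one_of_deriv_ne_zero (hY.deriv_ne hYo hw)
  have e3 : analyticOrderAt (fun ζ => f (ψ ζ) - w) z = analyticOrderAt (fun ζ => f ζ - w) (ψ z) :=
    analyticOrderAt_comp_of_deriv_ne_zero (f := fun ζ => f ζ - w) hψ (hX.symm.deriv_ne hXo hz)
  rw [analyticOrderNatAt, analyticOrderNatAt, e1, e2, e3, one_mul]

/-- A proper analytic map between bounded simply connected domains has a degree. -/
theorem exists_hasDegreeOn {f : ℂ → ℂ} {X Y : Set ℂ} (hXo : IsOpen X) (hXc : IsSimplyConnected X)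
    (hXb : Bornology.IsBounded X) (hYo : IsOpen Y) (hYc : IsSimplyConnected Y)
    (hYb : Bornology.IsBounded Y) (hf : AnalyticOnNhd ℂ f X) (hp : IsProperOn f X Y) :
    ∃ n, HasDegreeOn f X Y n := by
  obtain ⟨φ, ψ, hX⟩ := exists_biholo_ball hXo hXc hXb
  obtain ⟨φ', ψ', hY⟩ := exists_biholo_ball hYo hYc hYb
  have hB : AnalyticOnNhd ℂ (fun z => φ' (f (ψ z))) (ball 0 1) := fun z hz =>
    AnalyticAt.fun_comp (hY.analytic _ (hp.mapsTo (hX.mapsTo_inv hz)))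
      (AnalyticAt.fun_comp (hf _ (hX.mapsTo_inv hz)) (hX.analytic_inv z hz))
  obtain ⟨n, hn⟩ := exists_hasDegreeOn_ball hB (hp.conj hX hY)
  exact ⟨n, .of_conj hX isOpen_ball hY hYo hf hp.mapsTo hn⟩

end PolyLike

/-! ### Lifting a family through its central map by perturbations of the identity. -/

namespace PolyLike

open Filter Topology
open scoped Manifold ContDiff

/-- Near a compact set without critical points of `F 0`, the maps `F a` for small `a` factor as
`F 0 ∘ h (a, ·)` with `h` analytic and `h (0, ·)` the identity. -/
lemma exists_local_lift {F : ℂ → ℂ → ℂ} {T : Set ℂ} (hT : IsCompact T)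
    (hF : ∀ z ∈ T, AnalyticAt ℂ (fun p : ℂ × ℂ => F p.1 p.2) (0, z))
    (hd : ∀ z ∈ T, deriv (F 0) z ≠ 0) :
    ∃ h : ℂ × ℂ → ℂ, ∀ z ∈ T, AnalyticAt ℂ h (0, z) ∧ (∀ᶠ x in 𝓝 z, h (0, x) = x) ∧
      ∀ᶠ p in 𝓝 ((0 : ℂ), z), F 0 (h p) = F p.1 p.2 := by
  classical
  have hF0 : ∀ z ∈ T, AnalyticAt ℂ (F 0) z := fun z hz =>
    AnalyticAt.fun_comp (g := fun p : ℂ × ℂ => F p.1 p.2) (f := fun x => ((0 : ℂ), x))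
      (hF z hz) (by fun_prop)
  have hinj : ∀ z : T, ∃ c : Set ℂ, IsOpen c ∧ (z : ℂ) ∈ c ∧ InjOn (F 0) c := fun z => by
    have hs := (hF0 z z.2).hasStrictDerivAt.hasStrictFDerivAt_equiv (hd z z.2)
    exact ⟨(hs.toOpenPartialHomeomorph (F 0)).source, (hs.toOpenPartialHomeomorph (F 0)).open_source,
      hs.mem_toOpenPartialHomeomorph_source, (hs.toOpenPartialHomeomorph (F 0)).injOn⟩
  choose c hco hzc hci using hinj
  -- A Lebesgue number gives one radius on which `F 0` is injective about every point of `T`. Nearby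
  -- preimages are therefore unique and the local inverses glue.
  obtain ⟨δ, hδ, hδc⟩ := lebesgue_number_lemma_of_metric hT hco
    (fun z hz => mem_iUnion.2 ⟨⟨z, hz⟩, hzc ⟨z, hz⟩⟩)
  have hinjball : ∀ z ∈ T, InjOn (F 0) (ball z δ) := fun z hz =>
    let ⟨i, hi⟩ := hδc z hz
    (hci i).mono hi
  -- The lift picks a preimage within `δ / 2` of `p.2`. The default `p.2` is harmless: close to `(0,
  -- z)` with `z ∈ T` a preimage exists and equals `L (F p.1 p.2)`.
  let E : ℂ × ℂ → Prop := fun p => ∃ y ∈ ball p.2 (δ / 2), F 0 y = F p.1 p.2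
  refine ⟨fun p => if hp : E p then hp.choose else p.2, fun z hz => ?_⟩
  have hs := (hF0 z hz).hasStrictDerivAt
  set L := hs.localInverse _ _ _ (hd z hz) with hL
  have hLa : AnalyticAt ℂ L (F 0 z) := (hF0 z hz).analyticAt_localInverse (hd z hz)
  have hLz : L (F 0 z) = z := HasStrictFDerivAt.localInverse_apply_image ..
  have hcF : Tendsto (fun p : ℂ × ℂ => F p.1 p.2) (𝓝 (0, z)) (𝓝 (F 0 z)) :=
    (hF z hz).continuousAt
  have hLF : Tendsto (fun p : ℂ × ℂ => L (F p.1 p.2)) (𝓝 (0, z)) (𝓝 z) := by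
    have := hLa.continuousAt.tendsto.comp hcF
    rwa [hLz] at this
  have hright : ∀ᶠ p : ℂ × ℂ in 𝓝 (0, z), F 0 (L (F p.1 p.2)) = F p.1 p.2 :=
    hcF.eventually (HasStrictDerivAt.eventually_right_inverse hs (hd z hz))
  have hsnd : Tendsto (fun p : ℂ × ℂ => p.2) (𝓝 (0, z)) (𝓝 z) := continuous_snd.continuousAt
  have hδ4 : 0 < δ / 4 := by positivity
  have heq : ∀ᶠ p : ℂ × ℂ in 𝓝 (0, z),
      (if hp : E p then hp.choose else p.2) = L (F p.1 p.2) := by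
    filter_upwards [hright, hLF.eventually (ball_mem_nhds z hδ4),
      hsnd.eventually (ball_mem_nhds z hδ4)] with p h1 h2 h3
    change dist _ z < _ at h2 h3
    have hE : E p := ⟨L (F p.1 p.2), by
      rw [mem_ball]
      linarith [dist_triangle_right (L (F p.1 p.2)) p.2 z], h1⟩
    rw [dif_pos hE]
    have h4 := hE.choose_spec.1
    rw [mem_ball] at h4
    refine hinjball z hz ?_ ?_ (hE.choose_spec.2.trans h1.symm)
    · rw [mem_ball]; linarith [dist_triangle hE.choose p.2 z]
    · rw [mem_ball]; linarith
  have hmk : Tendsto (fun x : ℂ => ((0 : ℂ), x)) (𝓝 z) (𝓝 (0, z)) :=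
    (Continuous.prodMk_right (0 : ℂ)).continuousAt
  refine ⟨?_, ?_, ?_⟩
  · refine AnalyticAt.congr ?_ (heq.mono fun p hp => hp.symm)
    exact AnalyticAt.fun_comp (g := L) (f := fun p : ℂ × ℂ => F p.1 p.2) hLa (hF z hz)
  · have hleft : ∀ᶠ x in 𝓝 z, L (F 0 x) = x :=
      HasStrictFDerivAt.eventually_left_inverse (hs.hasStrictFDerivAt_equiv (hd z hz))
    filter_upwards [hmk.eventually heq, hleft] with x h1 h2
    exact h1.trans h2
  · filter_upwards [heq, hright] with p h1 h2
    rw [h1, h2]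

/-- Cut-off version of `exists_local_lift`: the lift is extended to homeomorphisms of the plane
close to the identity. -/
theorem exists_perturbation {F : ℂ → ℂ → ℂ} {U C : Set ℂ} (hU : IsOpen U) (hC : IsCompact C)
    (hCU : C ⊆ U) (hF : ∀ z ∈ U, AnalyticAt ℂ (fun p : ℂ × ℂ => F p.1 p.2) (0, z))
    (hd : ∀ z ∈ C, deriv (F 0) z ≠ 0) :
    ∃ (H : ℂ × ℂ → ℂ) (N T : Set ℂ), IsOpen N ∧ C ⊆ N ∧ N ⊆ T ∧ IsCompact T ∧ T ⊆ U ∧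
      (∀ z ∈ T, deriv (F 0) z ≠ 0) ∧ ∀ ε > 0, ∀ᶠ a in 𝓝 (0 : ℂ),
        (∀ z, ContinuousAt H (a, z)) ∧
        (∀ z w, ‖(H (a, z) - z) - (H (a, w) - w)‖ ≤ 1 / 2 * ‖z - w‖) ∧
        (∀ z, ‖H (a, z) - z‖ < ε) ∧ ∀ z ∈ N, F 0 (H (a, z)) = F a z := by
  have hF0 : AnalyticOnNhd ℂ (F 0) U := fun z hz =>
    AnalyticAt.fun_comp (g := fun p : ℂ × ℂ => F p.1 p.2) (f := fun x => ((0 : ℂ), x))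
      (hF z hz) (by fun_prop)
  have hopen : IsOpen (U ∩ deriv (F 0) ⁻¹' {0}ᶜ) :=
    hF0.deriv.continuousOn.isOpen_inter_preimage hU isOpen_compl_singleton
  obtain ⟨δ, hδ, hδU⟩ := hC.exists_cthickening_subset_open hopen fun z hz => ⟨hCU hz, hd z hz⟩
  set T := cthickening δ C with hTdef
  have hT : IsCompact T := hC.cthickening
  have hCT : C ⊆ interior T :=
    (self_subset_thickening hδ C).trans (interior_maximal (thickening_subset_cthickening δ C)
      isOpen_thickening)
  obtain ⟨h, hh⟩ := exists_local_lift hT (fun z hz => hF z (hδU hz).1) (fun z hz => (hδU hz).2)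
  obtain ⟨χ, hχ1, hχ0, -⟩ := exists_contMDiffMap_one_nhds_of_subset_interior (n := ⊤) 𝓘(ℝ, ℂ)
    hC.isClosed hCT
  have hχ : ContDiff ℝ ∞ χ := χ.contMDiff.contDiff
  -- The displacement of the lift, cut off to vanish outside `T`.
  set v : ℂ × ℂ → ℂ := fun p => χ p.2 • (h p - p.2) with hv
  have hvout : ∀ a z, z ∉ T → ∀ᶠ p in 𝓝 ((a : ℂ), z), v p = 0 := fun a z hz => by
    have : ∀ᶠ p : ℂ × ℂ in 𝓝 (a, z), p.2 ∈ Tᶜ :=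
      continuous_snd.continuousAt.eventually (hT.isClosed.isOpen_compl.mem_nhds hz)
    filter_upwards [this] with p hp
    simp [hv, hχ0 _ hp]
  have hvC : ∀ z ∈ T, ContDiffAt ℝ 1 v (0, z) := fun z hz => by
    have h1 : ContDiffAt ℝ 1 h (0, z) := (hh z hz).1.contDiffAt.restrict_scalars ℝ
    have h2 : ContDiffAt ℝ 1 (fun p : ℂ × ℂ => χ p.2) (0, z) :=
      ((hχ.of_le (by simp)).comp contDiff_snd).contDiffAt
    exact h2.smul (h1.sub contDiffAt_snd)
  have hv0 : ∀ z ∈ T, ∀ᶠ x in 𝓝 z, v (0, x) = 0 := fun z hz =>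
    (hh z hz).2.1.mono fun x hx => by simp [hv, hx]
  have hcomp : ∀ a x, DifferentiableAt ℝ v (a, x) → HasFDerivAt (fun y => v (a, y))
      ((fderiv ℝ v (a, x)).comp (ContinuousLinearMap.inr ℝ ℂ ℂ)) x := fun a x hvx =>
    hvx.hasFDerivAt.comp x (hasFDerivAt_prodMk_right a x)
  have hevT : ∀ ε > 0, ∀ᶠ a in 𝓝 (0 : ℂ), ∀ z ∈ T, (DifferentiableAt ℝ v (a, z) ∧
      ‖(fderiv ℝ v (a, z)).comp (ContinuousLinearMap.inr ℝ ℂ ℂ)‖ < 1 / 2) ∧ ‖v (a, z)‖ < ε ∧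
      F 0 (h (a, z)) = F a z := fun ε hε => by
    refine hT.eventually_forall_of_forall_eventually fun z hz => ?_
    have hdiff : ∀ᶠ p in 𝓝 ((0 : ℂ), z), DifferentiableAt ℝ v p :=
      ((hvC z hz).eventually (by simp)).mono fun p hp => hp.differentiableAt one_ne_zero
    have hder : ContinuousAt (fun p => (fderiv ℝ v p).comp (ContinuousLinearMap.inr ℝ ℂ ℂ))
        ((0 : ℂ), z) := ((hvC z hz).continuousAt_fderiv one_ne_zero).clm_comp continuousAt_const
    -- For `a = 0` the lift is the identity, so the `z`-derivative of `v` vanishes. As `v` is `C¹`,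
    -- compactness of `T` keeps this derivative below `1 / 2` for small `a`.
    have hzero : (fderiv ℝ v ((0 : ℂ), z)).comp (ContinuousLinearMap.inr ℝ ℂ ℂ) = 0 :=
      (hcomp 0 z hdiff.self_of_nhds).unique
        ((hasFDerivAt_const (0 : ℂ) z).congr_of_eventuallyEq (hv0 z hz))
    have hlt : ∀ᶠ p in 𝓝 ((0 : ℂ), z),
        ‖(fderiv ℝ v p).comp (ContinuousLinearMap.inr ℝ ℂ ℂ)‖ < 1 / 2 :=
      hder.norm.eventually_lt_const (by beta_reduce; rw [hzero]; simp)
    have hsm : ∀ᶠ p in 𝓝 ((0 : ℂ), z), ‖v p‖ < ε :=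
      (hvC z hz).continuousAt.norm.eventually_lt_const (by
        beta_reduce; rw [(hv0 z hz).self_of_nhds]; simpa using hε)
    filter_upwards [hdiff, hlt, hsm, (hh z hz).2.2] with p h1 h2 h3 h4
    exact ⟨⟨h1, h2⟩, h3, h4⟩
  refine ⟨fun p => p.2 + v p, interior {z | χ z = 1} ∩ interior T, T,
    isOpen_interior.inter isOpen_interior, fun z hz => ⟨?_, hCT hz⟩,
    inter_subset_right.trans interior_subset, hT, fun z hz => (hδU hz).1, fun z hz => (hδU hz).2,
    fun ε hε => ?_⟩
  · exact mem_interior_iff_mem_nhds.2 (eventually_nhdsSet_iff_forall.1 hχ1 z hz)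
  filter_upwards [hevT ε hε] with a ha
  have hdv : ∀ z, DifferentiableAt ℝ v (a, z) := fun z => by
    by_cases hz : z ∈ T
    · exact (ha z hz).1.1
    · exact (differentiableAt_const (0 : ℂ)).congr_of_eventuallyEq (hvout a z hz)
  refine ⟨fun z => continuousAt_snd.add (hdv z).continuousAt, fun z w => ?_, fun z => ?_,
    fun z hz => ?_⟩
  · simp only [add_sub_cancel_left]
    refine convex_univ.norm_image_sub_le_of_norm_hasFDerivWithin_le (𝕜 := ℝ) (x := w) (y := z)
      (f := fun y => v (a, y)) (fun x _ => (hcomp a x (hdv x)).hasFDerivWithinAt)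
      (fun x _ => ?_) (mem_univ _) (mem_univ _)
    by_cases hx : x ∈ T
    · exact (ha x hx).1.2.le
    · rw [(EventuallyEq.fderiv_eq (hvout a x hx) : fderiv ℝ v (a, x) = _)]
      simp
  · rw [add_sub_cancel_left]
    by_cases hz : z ∈ T
    · exact (ha z hz).2.1
    · rw [(hvout a z hz).self_of_nhds]; simpa using hε
  · have h1 : χ z = 1 := (interior_subset hz.1 : z ∈ {z | χ z = 1})
    rw [← (ha z (interior_subset hz.2)).2.2]
    simp [hv, h1]

/-- A Lipschitz perturbation of the identity is bijective. -/
lemma bijective_of_lipschitz_sub {H : ℂ → ℂ}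
    (hH : ∀ z w, ‖(H z - z) - (H w - w)‖ ≤ 1 / 2 * ‖z - w‖) : Function.Bijective H := by
  constructor
  · intro z w hzw
    have := hH z w
    rw [hzw, show (H w - z) - (H w - w) = -(z - w) by ring, norm_neg] at this
    exact sub_eq_zero.1 (norm_le_zero_iff.1 (by linarith [norm_nonneg (z - w)]))
  · intro w
    -- A fixed point of this contraction is a solution of `H z = w`.
    have hc : ContractingWith (1 / 2) (fun z => w - (H z - z)) := by
      refine ⟨by rw [← NNReal.coe_lt_coe]; norm_num, LipschitzWith.of_dist_le_mul fun x y => ?_⟩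
      rw [dist_eq_norm, dist_eq_norm, show w - (H x - x) - (w - (H y - y)) =
        -((H x - x) - (H y - y)) by ring, norm_neg]
      simpa using hH x y
    refine ⟨hc.fixedPoint _, ?_⟩
    have h2 : w - (H (hc.fixedPoint _) - hc.fixedPoint _) = hc.fixedPoint _ :=
      hc.fixedPoint_isFixedPt
    linear_combination -h2

lemma norm_sub_le_of_lipschitz_sub {H : ℂ → ℂ}
    (hH : ∀ z w, ‖(H z - z) - (H w - w)‖ ≤ 1 / 2 * ‖z - w‖) (z w : ℂ) :
    ‖z - w‖ ≤ 2 * ‖H z - H w‖ := by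
  have h1 := hH z w
  have h2 := norm_sub_le (H z - H w) ((H z - z) - (H w - w))
  rw [show H z - H w - ((H z - z) - (H w - w)) = z - w by ring] at h2
  linarith

end PolyLike

/-! ### Shrinking the range. -/

namespace PolyLike

open Filter Topology

lemma Biholo.restrict {φ ψ : ℂ → ℂ} {X Y X' Y' : Set ℂ} (h : Biholo φ ψ X Y) (hX : X' ⊆ X)
    (hY : Y' ⊆ Y) (hm : MapsTo φ X' Y') (hm' : MapsTo ψ Y' X') : Biholo φ ψ X' Y' :=
  ⟨h.analytic.mono hX, h.analytic_inv.mono hY, hm, hm', fun x hx => h.left_inv x (hX hx),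
    fun y hy => h.right_inv y (hY hy)⟩

lemma isSimplyConnected_of_homeomorph {X Y : Type*} [TopologicalSpace X] [TopologicalSpace Y]
    {s : Set X} {t : Set Y} (e : s ≃ₜ t) (ht : IsSimplyConnected t) : IsSimplyConnected s :=
  e.toHomotopyEquiv.simplyConnectedSpace_iff.2 ht

lemma StarConvex.isSimplyConnected {s : Set ℂ} (hs : StarConvex ℝ 0 s) (h0 : (0 : ℂ) ∈ s) :
    IsSimplyConnected s := by
  have := hs.contractibleSpace ⟨0, h0⟩
  exact (inferInstance : SimplyConnectedSpace s)

/-- The derivative does not vanish identically, so its zeros are isolated, and a discrete subset of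
the plane is countable. Only countably many radii are thus forbidden for the new range. -/
lemma countable_critical {f : ℂ → ℂ} {U : Set ℂ} (hU : IsOpen U) (hUc : IsPreconnected U)
    (hf : AnalyticOnNhd ℂ f U) (hnc : ∀ c, ¬ ∀ z ∈ U, f z = c) :
    {z | z ∈ U ∧ deriv f z = 0}.Countable := by
  set Z := {z | z ∈ U ∧ deriv f z = 0} with hZ
  have hiso : ∀ z ∈ Z, {z} ∈ 𝓝[Z] z := by
    rintro z ⟨hzU, -⟩
    rcases (hf.deriv z hzU).eventually_eq_zero_or_eventually_ne_zero with h | h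
    · have h0 := hf.deriv.eqOn_zero_of_preconnected_of_eventuallyEq_zero hUc hzU h
      obtain ⟨c, hc⟩ := hU.exists_is_const_of_deriv_eq_zero hUc hf.differentiableOn h0
      exact absurd hc (hnc c)
    · rw [eventually_nhdsWithin_iff] at h
      filter_upwards [self_mem_nhdsWithin, nhdsWithin_le_nhds h] with x hx hxz
      by_contra hne
      exact hxz hne hx.2
  obtain ⟨t, -, htc, ht⟩ := TopologicalSpace.countable_cover_nhdsWithin hiso
  refine htc.mono fun z hz => ?_
  obtain ⟨x, hx, hzx⟩ := mem_iUnion₂.1 (ht hz)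
  rw [mem_singleton_iff.1 hzx]
  exact hx

lemma exists_subset_preimage_ball {φ : ℂ → ℂ} {X T : Set ℂ} (hφ : ContinuousOn φ X)
    (hm : MapsTo φ X (ball 0 1)) (hT : IsCompact T) (hTX : T ⊆ X) :
    ∃ s < 1, ∀ z ∈ T, φ z ∈ ball (0 : ℂ) s := by
  obtain ⟨s, hs, h⟩ := exists_lt_subset_ball (hT.image_of_continuousOn (hφ.mono hTX)).isClosed
    ((image_mono hTX).trans hm.image_subset)
  exact ⟨s, hs, fun z hz => h (mem_image_of_mem φ hz)⟩

/-- The range of a polynomial-like map can be shrunk to a domain whose preimage is simply connected,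
and whose boundary does not meet the critical values. -/
theorem IsPolynomialLike.exists_shrink {d : ℕ} {f : ℂ → ℂ} {U V K : Set ℂ}
    (hf : IsPolynomialLike d f U V) (hK : IsCompact K) (hKU : K ⊆ U) :
    ∃ V' ⊆ V, IsOpen V' ∧ IsSimplyConnected V' ∧ closure U ⊆ V' ∧ (∀ z ∈ K, f z ∈ V') ∧
      IsSimplyConnected (U ∩ f ⁻¹' V') ∧ closure (U ∩ f ⁻¹' V') ⊆ U ∧
      ∀ z ∈ frontier (U ∩ f ⁻¹' V'), deriv f z ≠ 0 := by
  obtain ⟨φ, ψ, hV⟩ := exists_biholo_ball hf.isOpen_target hf.simplyConnected_target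
    hf.isBounded_target
  obtain ⟨φ', ψ', hU⟩ := exists_biholo_ball hf.isOpen_source hf.simplyConnected_source
    hf.isBounded_source
  have hfc := hf.analytic.continuousOn
  have hB : AnalyticOnNhd ℂ (fun z => φ (f (ψ' z))) (ball 0 1) := fun z hz =>
    AnalyticAt.fun_comp (hV.analytic _ (hf.proper.mapsTo (hU.mapsTo_inv hz)))
      (AnalyticAt.fun_comp (hf.analytic _ (hU.mapsTo_inv hz)) (hU.analytic_inv z hz))
  obtain ⟨s₀, hs₀, hstar⟩ := exists_starConvex_sublevel hB (hf.proper.conj hU hV)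
  obtain ⟨s₁, hs₁, hUs⟩ := exists_subset_preimage_ball hV.analytic.continuousOn hV.mapsTo
    hf.isBounded_source.isCompact_closure hf.closure_subset
  obtain ⟨s₂, hs₂, hKs⟩ := exists_subset_preimage_ball hV.analytic.continuousOn hV.mapsTo
    (hK.image_of_continuousOn (hfc.mono hKU)) (image_subset_iff.2 fun z hz =>
      hf.proper.mapsTo (hKU hz))
  have hnc : ∀ c, ¬ ∀ z ∈ U, f z = c := by
    intro c hc
    obtain ⟨z, hz⟩ := hf.simplyConnected_source.nonempty
    have hfin := (hf.degree (f z) (hf.proper.mapsTo hz)).1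
    have : U ⊆ U ∩ f ⁻¹' {f z} := fun x hx => ⟨hx, by simp [hc x hx, hc z hz]⟩
    exact infinite_of_mem_nhds z (hf.isOpen_source.mem_nhds hz) (hfin.subset this)
  have hcount : ((fun z => ‖φ (f z)‖) '' {z | z ∈ U ∧ deriv f z = 0}).Countable :=
    (countable_critical hf.isOpen_source
      hf.simplyConnected_source.isPathConnected.isConnected.isPreconnected hf.analytic hnc).image _
  -- The radius avoids the moduli of the critical values in Riemann coordinates. It exceeds `s₀` for
  -- star-shaped sublevel sets, `s₁` to keep `closure U` in the range, and `s₂` to keep the image of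
  -- `K` there.
  obtain ⟨s, hsc, hsgt, hs1⟩ := (hcount.dense_compl ℝ).exists_between
    (max_lt (max_lt hs₀ hs₁) hs₂)
  have h0s : s₀ < s := ((le_max_left _ _).trans (le_max_left _ _)).trans_lt hsgt
  have h1s : s₁ < s := ((le_max_right _ _).trans (le_max_left _ _)).trans_lt hsgt
  have h2s : s₂ < s := (le_max_right _ _).trans_lt hsgt
  have hsub : ball (0 : ℂ) s ⊆ ball 0 1 := ball_subset_ball hs1.le
  have hV' : Biholo φ ψ (V ∩ φ ⁻¹' ball 0 s) (ball 0 s) :=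
    hV.restrict inter_subset_left hsub (fun z hz => hz.2) fun z hz =>
      ⟨hV.mapsTo_inv (hsub hz), by rw [mem_preimage, hV.right_inv z (hsub hz)]; exact hz⟩
  have hV'o : IsOpen (V ∩ φ ⁻¹' ball 0 s) :=
    hV.analytic.continuousOn.isOpen_inter_preimage hf.isOpen_target isOpen_ball
  have hspos : 0 < s := by
    obtain ⟨z, hz⟩ := hf.simplyConnected_source.nonempty
    exact (pos_of_mem_ball (hUs z (subset_closure hz))).trans h1s
  obtain ⟨hsc0, h0mem⟩ := hstar s h0s
  have hU' : Biholo φ' ψ' (U ∩ f ⁻¹' (V ∩ φ ⁻¹' ball 0 s))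
      (ball 0 1 ∩ (fun z => φ (f (ψ' z))) ⁻¹' ball 0 s) := by
    refine hU.restrict inter_subset_left inter_subset_left (fun z hz => ⟨hU.mapsTo hz.1, ?_⟩)
      fun z hz => ⟨hU.mapsTo_inv hz.1, hf.proper.mapsTo (hU.mapsTo_inv hz.1), hz.2⟩
    rw [mem_preimage, hU.left_inv z hz.1]
    exact hz.2.2
  -- Properness over the closed disk confines the closure of the new source to a compact subset of
  -- `U`.
  have hE : IsCompact (U ∩ f ⁻¹' (ψ '' closedBall 0 s)) :=
    hf.proper.isCompact_preimage _
      (image_subset_iff.2 fun z hz => hV.mapsTo_inv (closedBall_subset_ball hs1 hz))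
      (hV.symm.isCompact_image (isCompact_closedBall _ _) (closedBall_subset_ball hs1))
  have hclos : closure (U ∩ f ⁻¹' (V ∩ φ ⁻¹' ball 0 s)) ⊆ U ∩ f ⁻¹' (ψ '' closedBall 0 s) :=
    closure_minimal (fun z hz => ⟨hz.1, φ (f z), ball_subset_closedBall hz.2.2,
      hV.left_inv _ hz.2.1⟩) hE.isClosed
  refine ⟨V ∩ φ ⁻¹' ball 0 s, inter_subset_left, hV'o, ?_, fun z hz => ⟨hf.closure_subset hz,
    ball_subset_ball h1s.le (hUs z hz)⟩, fun z hz => ⟨hf.proper.mapsTo (hKU hz),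
    ball_subset_ball h2s.le (hKs _ (mem_image_of_mem f hz))⟩, ?_, hclos.trans inter_subset_left, ?_⟩
  · exact isSimplyConnected_of_homeomorph hV'.homeomorph
      (StarConvex.isSimplyConnected ((convex_ball _ _).starConvex (by simpa using hspos))
        (by simpa using hspos))
  · exact isSimplyConnected_of_homeomorph hU'.homeomorph
      (StarConvex.isSimplyConnected hsc0 h0mem)
  · intro z hz hdz
    obtain ⟨hzU, y, hy, hyz⟩ := hclos hz.1
    have hfz : φ (f z) = y := by
      rw [← hyz, hV.right_inv y (closedBall_subset_ball hs1 hy)]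
    have hopen : IsOpen (U ∩ f ⁻¹' (V ∩ φ ⁻¹' ball 0 s)) :=
      hfc.isOpen_inter_preimage hf.isOpen_source hV'o
    have hnot : z ∉ U ∩ f ⁻¹' (V ∩ φ ⁻¹' ball 0 s) := by
      rw [hopen.frontier_eq] at hz; exact hz.2
    -- On the frontier `‖φ (f z)‖` equals `s`, which is not the modulus of a critical value.
    refine hsc ⟨z, ⟨hzU, hdz⟩, ?_⟩
    change ‖φ (f z)‖ = s
    rw [hfz]
    refine le_antisymm (mem_closedBall_zero_iff.1 hy) ?_
    by_contra! h
    exact hnot ⟨hzU, hf.proper.mapsTo hzU, by rw [mem_preimage, hfz]; exact mem_ball_zero_iff.2 h⟩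

end PolyLike

/-! ### Families of domains, their fibres and comparison of degrees. -/

namespace PolyLike

open Filter Topology

/-- The segment from `z` to `y` is connected and must cross the frontier. Hence only points close to
the frontier can be moved into `closure S` from outside `S` by a small displacement. -/
lemma mem_thickening_frontier {S : Set ℂ} (hS : IsOpen S) {y z : ℂ} {ε : ℝ} (hy : y ∈ closure S)
    (hz : z ∉ S) (h : dist z y < ε) : z ∈ thickening ε (frontier S) := by
  rw [mem_thickening_iff, hS.frontier_eq]
  by_cases hyS : y ∈ S
  swap
  · exact ⟨y, ⟨hy, hyS⟩, h⟩
  by_cases hzc : z ∈ closure S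
  · exact ⟨z, ⟨hzc, hz⟩, by rw [dist_self]; exact dist_nonneg.trans_lt h⟩
  by_contra! hno
  have hseg : IsPreconnected (segment ℝ z y) := (convex_segment z y).isPreconnected
  obtain ⟨x, -, hx1, hx2⟩ := hseg S (closure S)ᶜ hS isClosed_closure.isOpen_compl (fun x hx => by
    by_cases hxS : x ∈ S
    · exact Or.inl hxS
    · refine Or.inr fun hxc => ?_
      have h1 := hno x ⟨hxc, hxS⟩
      have h2 : dist z x ≤ dist z y := by
        have := segment_subset_closedBall_left z y hx
        rw [mem_closedBall, dist_comm] at this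
        rwa [dist_comm z y, dist_comm y z]
      linarith)
    ⟨y, right_mem_segment ℝ z y, hyS⟩ ⟨z, left_mem_segment ℝ z y, hzc⟩
  exact hx2 (subset_closure hx1)

/-- The homeomorphism of the plane given by a Lipschitz perturbation of the identity. -/
noncomputable def homeomorphOfLipschitzSub {H : ℂ → ℂ} (hc : Continuous H)
    (hH : ∀ z w, ‖(H z - z) - (H w - w)‖ ≤ 1 / 2 * ‖z - w‖) : ℂ ≃ₜ ℂ where
  toEquiv := Equiv.ofBijective H (bijective_of_lipschitz_sub hH)
  continuous_toFun := hc
  continuous_invFun := by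
    refine (LipschitzWith.of_dist_le_mul (K := 2) fun x y => ?_).continuous
    obtain ⟨x, rfl⟩ := (Equiv.ofBijective H (bijective_of_lipschitz_sub hH)).surjective x
    obtain ⟨y, rfl⟩ := (Equiv.ofBijective H (bijective_of_lipschitz_sub hH)).surjective y
    rw [Equiv.invFun_as_coe, Equiv.symm_apply_apply, Equiv.symm_apply_apply, dist_eq_norm,
      dist_eq_norm]
    exact norm_sub_le_of_lipschitz_sub hH x y

/-- A family of domains straightened by Lipschitz perturbations of the identity is trivial. -/
lemma isTrivialDiskFamily_of_perturbation {A X : Set ℂ} {H : ℂ × ℂ → ℂ} {W : ℂ → Set ℂ}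
    (hc : ∀ a ∈ A, ∀ z, ContinuousAt H (a, z))
    (hH : ∀ a ∈ A, ∀ z w, ‖(H (a, z) - z) - (H (a, w) - w)‖ ≤ 1 / 2 * ‖z - w‖)
    (hXo : IsOpen X) (hXc : IsSimplyConnected X) (hXb : Bornology.IsBounded X)
    (hW : ∀ a ∈ A, W a = (fun z => H (a, z)) ⁻¹' X) : IsTrivialDiskFamily A W := by
  obtain ⟨φ, ψ, hφ⟩ := exists_biholo_ball hXo hXc hXb
  have hbij : ∀ a : A, Function.Bijective fun z => H ((a : ℂ), z) := fun a =>
    bijective_of_lipschitz_sub (hH a a.2)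
  choose G hG using fun a : A => Function.bijective_iff_has_inverse.1 (hbij a)
  have hHG : ∀ (a : A) (w : ℂ), H ((a : ℂ), G a w) = w := fun a w => (hG a).2 w
  have hGH : ∀ (a : A) (z : ℂ), G a (H ((a : ℂ), z)) = z := fun a z => (hG a).1 z
  have hGc : Continuous fun q : A × X => G q.1 q.2 := by
    rw [continuous_iff_continuousAt]
    intro q
    -- Joint continuity of the inverses: the uniform Lipschitz bound controls the change of `G` by
    -- the error of the fixed point `G q.1 q.2` in the equation at nearby parameters.
    have h1 : Tendsto (fun p : A × X => 2 * ‖(p.2 : ℂ) - H ((p.1 : ℂ), G q.1 q.2)‖) (𝓝 q)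
        (𝓝 0) := by
      have h2 : ContinuousAt (fun p : A × X => H ((p.1 : ℂ), G q.1 q.2)) q := by
        refine ContinuousAt.comp (f := fun p : A × X => ((p.1 : ℂ), G q.1 q.2)) (g := H)
          (hc _ q.1.2 _) ?_
        fun_prop
      have h3 : ContinuousAt (fun p : A × X => 2 * ‖(p.2 : ℂ) - H ((p.1 : ℂ), G q.1 q.2)‖) q :=
        continuousAt_const.mul
          ((continuous_subtype_val.comp continuous_snd).continuousAt.sub h2).norm
      have := h3.tendsto
      simpa [hHG] using this
    refine tendsto_iff_norm_sub_tendsto_zero.2 (squeeze_zero (fun _ => norm_nonneg _) (fun p => ?_)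
      h1)
    have := norm_sub_le_of_lipschitz_sub (hH p.1 p.1.2) (G p.1 p.2) (G q.1 q.2)
    rwa [hHG] at this
  let e : totalSpace A W ≃ₜ A × X :=
    { toFun := fun p => (⟨p.1.1, p.2.1⟩, ⟨H p.1, by
        have := p.2.2
        rwa [hW _ p.2.1] at this⟩)
      invFun := fun q => ⟨((q.1 : ℂ), G q.1 q.2), q.1.2, by
        change G q.1 q.2 ∈ W (q.1 : ℂ)
        rw [hW _ q.1.2, mem_preimage, hHG]
        exact q.2.2⟩
      left_inv := fun p => Subtype.ext (Prod.ext rfl (hGH ⟨p.1.1, p.2.1⟩ p.1.2))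
      right_inv := fun q => Prod.ext rfl (Subtype.ext (hHG q.1 q.2))
      continuous_toFun := by
        refine Continuous.prodMk (by fun_prop) (Continuous.subtype_mk ?_ _)
        rw [continuous_iff_continuousAt]
        exact fun p => ContinuousAt.comp (g := H) (f := Subtype.val) (x := p) (hc p.1.1 p.2.1 p.1.2)
          continuousAt_subtype_val
      continuous_invFun := by
        exact Continuous.subtype_mk
          ((continuous_subtype_val.comp continuous_fst).prodMk hGc) _ }
  exact ⟨e.trans ((Homeomorph.refl A).prodCongr hφ.homeomorph), fun p => rfl⟩

lemma isProperOn_fst_of_subset {A B V' : Set ℂ} {W : ℂ → Set ℂ} (hB : IsCompact B) (hBV : B ⊆ V')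
    (hW : ∀ a ∈ A, W a ⊆ B) :
    IsProperOn Prod.fst (closure (totalSpace A W) ∩ totalSpace A fun _ => V') A := by
  refine ⟨fun p hp => hp.2.1, fun C hCA hC => ?_⟩
  have hcl : closure (totalSpace A W) ⊆ {p | p.2 ∈ B} :=
    closure_minimal (fun p hp => hW _ hp.1 hp.2) (hB.isClosed.preimage continuous_snd)
  have : closure (totalSpace A W) ∩ (totalSpace A fun _ => V') ∩ Prod.fst ⁻¹' C =
      (C ×ˢ B) ∩ closure (totalSpace A W) := by
    ext p
    exact ⟨fun h => ⟨⟨h.2, hcl h.1.1⟩, h.1.1⟩,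
      fun h => ⟨⟨h.2, hCA h.1.1, hBV h.1.2⟩, h.1.1⟩⟩
  rw [this]
  exact (hC.prod hB).inter_right isClosed_closure

/-- The fibres of a proper map over a parameter space are proper. -/
lemma IsProperOn.fiber {A : Set ℂ} {F : ℂ → ℂ → ℂ} {W : ℂ → Set ℂ} {V' : Set ℂ}
    (h : IsProperOn (fun p : ℂ × ℂ => (p.1, F p.1 p.2)) (totalSpace A W) (totalSpace A fun _ => V'))
    {a : ℂ} (ha : a ∈ A) : IsProperOn (F a) (W a) V' := by
  refine ⟨fun z hz => (h.mapsTo (show (a, z) ∈ totalSpace A W from ⟨ha, hz⟩)).2, fun C hCV hC => ?_⟩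
  have := (h.isCompact_preimage ({a} ×ˢ C) (by
    rintro ⟨b, z⟩ ⟨hb, hz⟩
    obtain rfl : b = a := hb
    exact ⟨ha, hCV hz⟩) (isCompact_singleton.prod hC)).image continuous_snd
  convert this using 1
  ext z
  constructor
  · rintro ⟨hz, hzC⟩
    exact ⟨(a, z), ⟨⟨ha, hz⟩, rfl, hzC⟩, rfl⟩
  · rintro ⟨⟨b, x⟩, ⟨⟨-, hx⟩, hb, hxC⟩, rfl⟩
    rw [mem_singleton_iff] at hb
    dsimp only at hb hx hxC ⊢
    rw [hb] at hx
    refine ⟨hx, ?_⟩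
    simpa [hb] using hxC

/-- The degree of a map which is conjugate to a map of degree `d` over one non-critical value. -/
lemma HasDegreeOn.eq_of_bijOn {f g e : ℂ → ℂ} {X Y Z : Set ℂ} {n d : ℕ} {w : ℂ}
    (hf : HasDegreeOn f X Z n) (hg : HasDegreeOn g Y Z d) (hw : w ∈ Z)
    (he : BijOn e (X ∩ f ⁻¹' {w}) (Y ∩ g ⁻¹' {w}))
    (hfa : ∀ z ∈ X ∩ f ⁻¹' {w}, AnalyticAt ℂ f z ∧ deriv f z ≠ 0)
    (hga : ∀ z ∈ Y ∩ g ⁻¹' {w}, AnalyticAt ℂ g z ∧ deriv g z ≠ 0) : n = d := by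
  have hone : ∀ (f : ℂ → ℂ) (z : ℂ), f z = w → AnalyticAt ℂ f z ∧ deriv f z ≠ 0 →
      analyticOrderNatAt (fun ζ => f ζ - w) z = 1 := by
    rintro f z rfl ⟨h1, h2⟩
    rw [analyticOrderNatAt, h1.analyticOrderAt_sub_eq_one_of_deriv_ne_zero h2]
    rfl
  rw [← (hf w hw).2, ← (hg w hw).2]
  refine finsum_mem_eq_of_bijOn e he fun z hz => ?_
  rw [hone f z hz.2 (hfa z hz), hone g (e z) (he.mapsTo hz).2 (hga _ (he.mapsTo hz))]

end PolyLike

/-! ### Construction of the analytic family. -/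

namespace PolyLike

open Filter Topology

lemma analyticAt_slice {F : ℂ → ℂ → ℂ} {a z : ℂ}
    (h : AnalyticAt ℂ (fun p : ℂ × ℂ => F p.1 p.2) (a, z)) : AnalyticAt ℂ (F a) z :=
  AnalyticAt.fun_comp (g := fun p : ℂ × ℂ => F p.1 p.2) (f := fun x => (a, x)) h (by fun_prop)

/-- The slice derivative is the full derivative applied to `(0, 1)`, hence continuous in both
variables. -/
lemma eventually_deriv_slice_ne {F : ℂ → ℂ → ℂ} {z : ℂ}
    (h : AnalyticAt ℂ (fun p : ℂ × ℂ => F p.1 p.2) (0, z)) (hd : deriv (F 0) z ≠ 0) :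
    ∀ᶠ p in 𝓝 ((0 : ℂ), z), deriv (F p.1) p.2 ≠ 0 := by
  have key : ∀ p : ℂ × ℂ, AnalyticAt ℂ (fun p : ℂ × ℂ => F p.1 p.2) p →
      deriv (F p.1) p.2 = fderiv ℂ (fun p : ℂ × ℂ => F p.1 p.2) p (0, 1) := fun p hp => by
    have h1 : HasDerivAt (fun x : ℂ => (p.1, x)) ((0 : ℂ), (1 : ℂ)) p.2 :=
      (hasDerivAt_const _ _).prodMk (hasDerivAt_id _)
    exact (HasFDerivAt.comp_hasDerivAt p.2
      (l := fun p : ℂ × ℂ => F p.1 p.2) hp.differentiableAt.hasFDerivAt h1).deriv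
  have hc : ContinuousAt (fun p => fderiv ℂ (fun p : ℂ × ℂ => F p.1 p.2) p (0, 1)) ((0 : ℂ), z) :=
    h.fderiv.continuousAt.clm_apply continuousAt_const
  have hne : fderiv ℂ (fun p : ℂ × ℂ => F p.1 p.2) ((0 : ℂ), z) (0, 1) ≠ 0 := by
    rw [← key _ h]; exact hd
  filter_upwards [hc.eventually_ne hne, h.eventually_analyticAt] with p h1 h2
  rw [key p h2]
  exact h1

lemma not_isCompact_of_isOpen {V : Set ℂ} (hV : IsOpen V) (hne : V.Nonempty) : ¬ IsCompact V := by
  intro hc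
  rcases isClopen_iff.1 ⟨hc.isClosed, hV⟩ with h | h
  · exact hne.ne_empty h
  · exact noncompact_univ ℂ (h ▸ hc)

/-- The maps `F a`, for small `a`, form an analytic family over a domain `V'` whose boundary does not
meet the critical values of `F 0`. -/
theorem exists_isAnalyticFamily {d : ℕ} (hd2 : 2 ≤ d) {F : ℂ → ℂ → ℂ} {U V' K : Set ℂ} {r : ℝ}
    (hr : 0 < r) (hU : IsOpen U) (hUb : Bornology.IsBounded U)
    (hF : AnalyticOnNhd ℂ (fun p : ℂ × ℂ => F p.1 p.2) (ball (0 : ℂ) r ×ˢ U))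
    (hVo : IsOpen V') (hVc : IsSimplyConnected V') (hVb : Bornology.IsBounded V')
    (hUV : closure U ⊆ V') (hSc : IsSimplyConnected (U ∩ F 0 ⁻¹' V'))
    (hSU : closure (U ∩ F 0 ⁻¹' V') ⊆ U) (hcrit : ∀ z ∈ frontier (U ∩ F 0 ⁻¹' V'), deriv (F 0) z ≠ 0)
    (hdeg : HasDegreeOn (F 0) (U ∩ F 0 ⁻¹' V') V' d) (hK : IsCompact K)
    (hKS : K ⊆ U ∩ F 0 ⁻¹' V') :
    ∃ ρ : ℝ, 0 < ρ ∧ ρ ≤ r ∧ ∃ Ua : ℂ → Set ℂ, (∀ a ∈ ball (0 : ℂ) ρ, K ⊆ Ua a ∧ Ua a ⊆ U) ∧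
      IsAnalyticFamily d (ball (0 : ℂ) ρ) F Ua fun _ => V' := by
  have hF0 : ∀ z ∈ U, AnalyticAt ℂ (fun p : ℂ × ℂ => F p.1 p.2) (0, z) := fun z hz =>
    hF _ ⟨mem_ball_self hr, hz⟩
  have hf : AnalyticOnNhd ℂ (F 0) U := fun z hz => analyticAt_slice (hF0 z hz)
  set S := U ∩ F 0 ⁻¹' V' with hSdef
  have hSo : IsOpen S := hf.continuousOn.isOpen_inter_preimage hU hVo
  have hSb : Bornology.IsBounded S := hUb.subset inter_subset_left
  have hclc : IsCompact (closure S) := hSb.isCompact_closure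
  have hfr : IsCompact (frontier S) := hclc.of_isClosed_subset isClosed_frontier
    frontier_subset_closure
  have hfrV : ∀ z ∈ frontier S, F 0 z ∉ V' := fun z hz hzV => by
    rw [hSo.frontier_eq] at hz
    exact hz.2 ⟨hSU hz.1, hzV⟩
  obtain ⟨H, N, T, hNo, hfrN, hNT, hT, hTU, hTd, hH⟩ := exists_perturbation hU hfr
    (frontier_subset_closure.trans hSU) hF0 hcrit
  obtain ⟨δ₁, hδ₁, hδN⟩ := hfr.exists_thickening_subset_open hNo hfrN
  obtain ⟨δ₂, hδ₂, hδK⟩ := hK.exists_thickening_subset_open hSo hKS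
  obtain ⟨δ₃, hδ₃, hδU⟩ := hclc.exists_thickening_subset_open hU hSU
  -- Displacements below `ε` keep points that land within `δ₁ / 2` of the frontier inside `N`, keep
  -- `K` in the new sources (`δ₂`), and keep those sources in `U` (`δ₃`).
  set ε := min (δ₁ / 2) (min δ₂ δ₃) with hε
  have hε0 : 0 < ε := by positivity
  have hε1 : ε ≤ δ₁ / 2 := min_le_left _ _
  -- the part of `closure S` away from the frontier
  set D := closure S \ thickening (δ₁ / 2) (frontier S) with hD
  have hDc : IsCompact D := hclc.diff isOpen_thickening
  have hDS : D ⊆ S := fun z hz => by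
    by_contra hzS
    exact hz.2 (self_subset_thickening (by positivity) _ (by
      rw [hSo.frontier_eq]; exact ⟨hz.1, hzS⟩))
  -- The compact image of `D` cannot fill the nonempty open set `V'`. All preimages of `w` in `S`
  -- thus lie in the collar near the frontier.
  obtain ⟨w, hwV, hwD⟩ : ∃ w ∈ V', w ∉ F 0 '' D := by
    by_contra! h
    refine not_isCompact_of_isOpen hVo hVc.nonempty ?_
    rw [show V' = F 0 '' D from Subset.antisymm h (image_subset_iff.2 fun z hz => (hDS hz).2)]
    exact hDc.image_of_continuousOn (hf.continuousOn.mono fun z hz => (hDS hz).1)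
  have hevD : ∀ᶠ a in 𝓝 (0 : ℂ), ∀ z ∈ D, F a z ∈ V' ∧ F a z ≠ w :=
    hDc.eventually_forall_of_forall_eventually fun z hz => by
      have hc := (hF0 z (hDS hz).1).continuousAt
      exact (hc.eventually (hVo.mem_nhds (hDS hz).2)).and
        (hc.eventually_ne fun h => hwD ⟨z, hz, h⟩)
  have hevT : ∀ᶠ a in 𝓝 (0 : ℂ), ∀ z ∈ T, deriv (F a) z ≠ 0 :=
    hT.eventually_forall_of_forall_eventually fun z hz =>
      eventually_deriv_slice_ne (hF0 z (hTU hz)) (hTd z hz)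
  obtain ⟨ρ, hρ, hball⟩ := Metric.eventually_nhds_iff_ball.1
    (((hH ε hε0).and (hevD.and hevT)).and (ball_mem_nhds (0 : ℂ) hr))
  have hHc : ∀ a ∈ ball (0 : ℂ) (min ρ r), ∀ z, ContinuousAt H (a, z) := fun a ha =>
    (hball a (ball_subset_ball (min_le_left _ _) ha)).1.1.1
  have hHl : ∀ a ∈ ball (0 : ℂ) (min ρ r), ∀ z w,
      ‖(H (a, z) - z) - (H (a, w) - w)‖ ≤ 1 / 2 * ‖z - w‖ := fun a ha =>
    (hball a (ball_subset_ball (min_le_left _ _) ha)).1.1.2.1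
  have hHε : ∀ a ∈ ball (0 : ℂ) (min ρ r), ∀ z, dist z (H (a, z)) < ε := fun a ha z => by
    rw [dist_comm, dist_eq_norm]
    exact (hball a (ball_subset_ball (min_le_left _ _) ha)).1.1.2.2.1 z
  have hHN : ∀ a ∈ ball (0 : ℂ) (min ρ r), ∀ z ∈ N, F 0 (H (a, z)) = F a z := fun a ha =>
    (hball a (ball_subset_ball (min_le_left _ _) ha)).1.1.2.2.2
  have hFD : ∀ a ∈ ball (0 : ℂ) (min ρ r), ∀ z ∈ D, F a z ∈ V' ∧ F a z ≠ w := fun a ha =>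
    (hball a (ball_subset_ball (min_le_left _ _) ha)).1.2.1
  have hFT : ∀ a ∈ ball (0 : ℂ) (min ρ r), ∀ z ∈ T, deriv (F a) z ≠ 0 := fun a ha =>
    (hball a (ball_subset_ball (min_le_left _ _) ha)).1.2.2
  have har : ∀ a ∈ ball (0 : ℂ) (min ρ r), a ∈ ball (0 : ℂ) r := fun a ha =>
    ball_subset_ball (min_le_right _ _) ha
  have hSub : thickening (δ₁ / 2) (frontier S) ⊆ N :=
    (thickening_mono (by linarith) _).trans hδN
  set A := ball (0 : ℂ) (min ρ r) with hA
  have hAo : IsOpen A := isOpen_ball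
  have hHU : ∀ a ∈ A, ∀ z, H (a, z) ∈ closure S → z ∈ U := fun a ha z hz =>
    hδU (mem_thickening_iff.2 ⟨_, hz, (hHε a ha z).trans_le
      ((min_le_right _ _).trans (min_le_right _ _))⟩)
  -- Outside `D` the lifting identity on `N` is available; on `D` the map `F a` is merely close to
  -- `F 0`.
  have hcollar : ∀ a ∈ A, ∀ z, H (a, z) ∈ closure S → z ∉ D → z ∈ N := fun a ha z hz hzD => by
    by_cases hzS : z ∈ S
    · by_contra h
      exact hzD ⟨subset_closure hzS, fun h' => h (hSub h')⟩
    · exact hSub (thickening_mono hε1 _ (mem_thickening_frontier hSo hz hzS (hHε a ha z)))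
  have hmaps : ∀ a ∈ A, ∀ z, H (a, z) ∈ S → F a z ∈ V' := fun a ha z hz => by
    by_cases hzD : z ∈ D
    · exact (hFD a ha z hzD).1
    · rw [← hHN a ha z (hcollar a ha z (subset_closure hz) hzD)]
      exact hz.2
  have hFa : ∀ a ∈ A, ∀ z ∈ U, AnalyticAt ℂ (fun p : ℂ × ℂ => F p.1 p.2) (a, z) :=
    fun a ha z hz => hF _ ⟨har a ha, hz⟩
  have hanal : AnalyticOnNhd ℂ (fun p : ℂ × ℂ => (p.1, F p.1 p.2)) (A ×ˢ U) := fun p hp =>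
    AnalyticAt.prod analyticAt_fst (hFa p.1 hp.1 p.2 hp.2)
  set W : ℂ → Set ℂ := fun a => (fun z => H (a, z)) ⁻¹' S with hW
  have hWU : ∀ a ∈ A, W a ⊆ U := fun a ha z hz => hHU a ha z (subset_closure hz)
  have hprop : IsProperOn (fun p : ℂ × ℂ => (p.1, F p.1 p.2)) (totalSpace A W)
      (totalSpace A fun _ => V') := by
    refine ⟨fun p hp => ⟨hp.1, hmaps p.1 hp.1 p.2 hp.2⟩, fun C hCV hC => ?_⟩
    have hB : IsCompact (Prod.fst '' C) := hC.image continuous_fst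
    have hBA : Prod.fst '' C ⊆ A := image_subset_iff.2 fun p hp => (hCV hp).1
    have hbox : IsCompact ((Prod.fst '' C) ×ˢ closure U) := hB.prod hUb.isCompact_closure
    have hHcont : ContinuousOn H ((Prod.fst '' C) ×ˢ closure U) := fun p hp =>
      (hHc p.1 (hBA hp.1) p.2).continuousWithinAt
    -- Replacing `S` by its closure gives a compact set. The added points have `H p` in the
    -- frontier, where `F p.1 p.2 = F 0 (H p)` lies outside `V'`, so they are not in the preimage of
    -- `C`.
    have hQ : IsCompact ((Prod.fst '' C) ×ˢ closure U ∩ H ⁻¹' closure S) :=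
      hbox.of_isClosed_subset
        (hHcont.preimage_isClosed_of_isClosed hbox.isClosed isClosed_closure) inter_subset_left
    have hQU : (Prod.fst '' C) ×ˢ closure U ∩ H ⁻¹' closure S ⊆ A ×ˢ U := fun p hp =>
      ⟨hBA hp.1.1, hHU p.1 (hBA hp.1.1) p.2 hp.2⟩
    have hR := hQ.of_isClosed_subset
      ((hanal.continuousOn.mono hQU).preimage_isClosed_of_isClosed hQ.isClosed hC.isClosed)
      inter_subset_left
    convert hR using 1
    ext p
    constructor
    · rintro ⟨hp, hpC⟩
      exact ⟨⟨⟨⟨_, hpC, rfl⟩, subset_closure (hWU p.1 hp.1 hp.2)⟩, subset_closure hp.2⟩, hpC⟩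
    · rintro ⟨hp, hpC⟩
      have hpA : p.1 ∈ A := hBA hp.1.1
      refine ⟨⟨hpA, ?_⟩, hpC⟩
      by_contra hpS
      have hpf : H p ∈ frontier S := by rw [hSo.frontier_eq]; exact ⟨hp.2, hpS⟩
      have hpN : p.2 ∈ N := hSub (mem_thickening_iff.2 ⟨_, hpf, (hHε p.1 hpA p.2).trans_le hε1⟩)
      refine hfrV _ hpf ?_
      rw [hHN p.1 hpA p.2 hpN]
      exact (hCV hpC).2
  have hcont : ∀ a ∈ A, Continuous fun z => H (a, z) := fun a ha =>
    continuous_iff_continuousAt.2 fun z => ContinuousAt.comp (g := H) (f := fun z => (a, z))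
      (hHc a ha z) (by fun_prop)
  have hWo : ∀ a ∈ A, IsOpen (W a) := fun a ha => hSo.preimage (hcont a ha)
  have hWc : ∀ a ∈ A, IsSimplyConnected (W a) := fun a ha =>
    (homeomorphOfLipschitzSub (hcont a ha) (hHl a ha)).isSimplyConnected_preimage.2 hSc
  have hWan : ∀ a ∈ A, AnalyticOnNhd ℂ (F a) (W a) := fun a ha z hz =>
    analyticAt_slice (hFa a ha z (hWU a ha hz))
  have hWdeg : ∀ a ∈ A, HasDegreeOn (F a) (W a) V' d := fun a ha => by
    obtain ⟨n, hn⟩ := exists_hasDegreeOn (hWo a ha) (hWc a ha) (hUb.subset (hWU a ha)) hVo hVc hVb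
      (hWan a ha) (hprop.fiber ha)
    have hfibN : ∀ z ∈ W a ∩ F a ⁻¹' {w}, z ∈ N := fun z hz =>
      hcollar a ha z (subset_closure hz.1) fun hzD => (hFD a ha z hzD).2 hz.2
    have hfib0 : ∀ y ∈ S ∩ F 0 ⁻¹' {w}, y ∈ thickening (δ₁ / 2) (frontier S) := fun y hy => by
      by_contra h
      exact hwD ⟨y, ⟨subset_closure hy.1, h⟩, hy.2⟩
    have hbij := bijective_of_lipschitz_sub (hHl a ha)
    -- Over `w` both fibres lie in the collar, where `H (a, ·)` conjugates `F a` to `F 0` and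
    -- neither map is critical; the degrees can be compared by counting points.
    have he : BijOn (fun z => H (a, z)) (W a ∩ F a ⁻¹' {w}) (S ∩ F 0 ⁻¹' {w}) := by
      refine ⟨fun z hz => ⟨hz.1, ?_⟩, hbij.injective.injOn, fun y hy => ?_⟩
      · rw [mem_preimage, hHN a ha z (hfibN z hz)]
        exact hz.2
      · obtain ⟨z, rfl⟩ := hbij.surjective y
        obtain ⟨x, hx, hxy⟩ := mem_thickening_iff.1 (hfib0 _ hy)
        have hzN : z ∈ N := hδN (mem_thickening_iff.2 ⟨x, hx, by
          linarith [dist_triangle z (H (a, z)) x, hHε a ha z]⟩)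
        exact ⟨z, ⟨hy.1, by rw [mem_preimage, ← hHN a ha z hzN]; exact hy.2⟩, rfl⟩
    have hnd : n = d := hn.eq_of_bijOn hdeg hwV he
      (fun z hz => ⟨hWan a ha z hz.1, hFT a ha z (hNT (hfibN z hz))⟩)
      (fun y hy => ⟨hf y hy.1.1, hTd y (hNT (hSub (hfib0 y hy)))⟩)
    exact hnd ▸ hn
  refine ⟨min ρ r, lt_min hρ hr, min_le_right _ _, W, fun a ha => ⟨fun z hz => ?_, hWU a ha⟩, ?_⟩
  · exact hδK (mem_thickening_iff.2 ⟨z, hz, by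
      rw [dist_comm]
      exact (hHε a ha z).trans_le ((min_le_right _ _).trans (min_le_left _ _))⟩)
  · exact
      { isOpen_param := hAo
        isConnected_param := (convex_ball _ _).isConnected ⟨0, mem_ball_self (lt_min hρ hr)⟩
        polynomialLike := fun a ha =>
          { two_le_degree := hd2
            isOpen_source := hWo a ha
            isOpen_target := hVo
            simplyConnected_source := hWc a ha
            simplyConnected_target := hVc
            isBounded_source := hUb.subset (hWU a ha)
            isBounded_target := hVb
            closure_subset := (closure_mono (hWU a ha)).trans hUV
            analytic := hWan a ha
            proper := hprop.fiber ha
            degree := hWdeg a ha }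
        trivial_source := isTrivialDiskFamily_of_perturbation hHc hHl hSo hSc hSb fun _ _ => rfl
        trivial_target := isTrivialDiskFamily_of_perturbation (H := Prod.snd)
          (fun _ _ _ => continuousAt_snd) (fun _ _ z w => by simp) hVo hVc hVb
          fun _ _ => rfl
        proper_projection := isProperOn_fst_of_subset hUb.isCompact_closure hUV
          fun a ha => (hWU a ha).trans subset_closure
        analytic := hanal.mono fun p hp => ⟨hp.1, hWU p.1 hp.1 hp.2⟩
        proper := hprop }

lemma HasDegreeOn.congr {f g : ℂ → ℂ} {U V : Set ℂ} {d : ℕ} (hU : IsOpen U) (hfg : EqOn f g U)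
    (hf : HasDegreeOn f U V d) : HasDegreeOn g U V d := by
  intro w hw
  have hset : U ∩ g ⁻¹' {w} = U ∩ f ⁻¹' {w} := by
    ext z
    simp only [mem_inter_iff, mem_preimage, mem_singleton_iff, and_congr_right_iff]
    intro hz
    rw [hfg hz]
  rw [hset]
  refine ⟨(hf w hw).1, ?_⟩
  rw [← (hf w hw).2]
  refine finsum_mem_congr rfl fun z hz => ?_
  rw [analyticOrderNatAt, analyticOrderNatAt, analyticOrderAt_congr]
  filter_upwards [hU.mem_nhds hz.1] with x hx
  rw [hfg hx]

lemma HasDegreeOn.inter_preimage {f : ℂ → ℂ} {U V V' : Set ℂ} {d : ℕ} (hV : V' ⊆ V)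
    (hf : HasDegreeOn f U V d) : HasDegreeOn f (U ∩ f ⁻¹' V') V' d := by
  intro w hw
  have hset : U ∩ f ⁻¹' V' ∩ f ⁻¹' {w} = U ∩ f ⁻¹' {w} := by
    ext z
    exact ⟨fun h => ⟨h.1.1, h.2⟩, fun h => ⟨⟨h.1, by
      rw [mem_preimage, show f z = w from h.2]; exact hw⟩, h.2⟩⟩
  rw [hset]
  exact hf w (hV hw)

lemma IsPolynomialLike.congr {f g : ℂ → ℂ} {U V : Set ℂ} {d : ℕ} (hfg : EqOn f g U)
    (hf : IsPolynomialLike d f U V) : IsPolynomialLike d g U V where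
  two_le_degree := hf.two_le_degree
  isOpen_source := hf.isOpen_source
  isOpen_target := hf.isOpen_target
  simplyConnected_source := hf.simplyConnected_source
  simplyConnected_target := hf.simplyConnected_target
  isBounded_source := hf.isBounded_source
  isBounded_target := hf.isBounded_target
  closure_subset := hf.closure_subset
  analytic := hf.analytic.congr hf.isOpen_source hfg
  proper := ⟨hf.proper.mapsTo.congr hfg, fun C hCV hC => by
    convert hf.proper.isCompact_preimage C hCV hC using 1
    ext z
    simp only [mem_inter_iff, mem_preimage, and_congr_right_iff]
    intro hz
    rw [hfg hz]⟩
  degree := hf.degree.congr hf.isOpen_source hfg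

end PolyLike

theorem mainTheorem11 (d : ℕ) (f : ℂ → ℂ) (U V : Set ℂ)
    (hf : PolyLike.IsPolynomialLike d f U V)
    (r : ℝ) (hr : 0 < r) (F : ℂ → ℂ → ℂ)
    (hF : AnalyticOnNhd ℂ (fun p : ℂ × ℂ => F p.1 p.2) (Metric.ball (0 : ℂ) r ×ˢ U))
    (hF0 : Set.EqOn (F 0) f U)
    (K : Set ℂ) (hK : IsCompact K) (hJK : PolyLike.filledJulia f U ⊆ K) (hKU : K ⊆ U) :
    ∃ ρ : ℝ, 0 < ρ ∧ ρ ≤ r ∧ ∃ (V' : Set ℂ) (Ua : ℂ → Set ℂ),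
      V' ⊆ V ∧
      (∀ a ∈ Metric.ball (0 : ℂ) ρ, K ⊆ Ua a ∧ Ua a ⊆ U ∧ Ua a ⊆ V') ∧
      PolyLike.IsAnalyticFamily d (Metric.ball (0 : ℂ) ρ) F Ua (fun _ => V') := by
  have hf' : PolyLike.IsPolynomialLike d (F 0) U V := hf.congr hF0.symm
  obtain ⟨V', hV'V, hVo, hVc, hUV, hKV, hSc, hSU, hcrit⟩ := hf'.exists_shrink hK hKU
  obtain ⟨ρ, hρ, hρr, Ua, hUa, hfam⟩ := PolyLike.exists_isAnalyticFamily hf.two_le_degree hr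
    hf.isOpen_source hf.isBounded_source hF hVo hVc (hf.isBounded_target.subset hV'V) hUV hSc hSU
    hcrit (hf'.degree.inter_preimage hV'V) hK fun z hz => ⟨hKU hz, hKV z hz⟩
  exact ⟨ρ, hρ, hρr, V', Ua, hV'V, fun a ha => ⟨(hUa a ha).1, (hUa a ha).2,
    ((hUa a ha).2.trans subset_closure).trans hUV⟩, hfam⟩
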